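/- Let $\mathsf{LOG}$ be a propositional variant of linear logic: a fragment of multiplicative-additive linear logic (MALL) whose language contains at least $\mathbf 1,\otimes,\multimap$ and, in the classical case, the negation $\sim$; with the weakening rule (affine) or without it (linear); and either classical, with sequents $\Gamma\vdash\Delta$ between finite multisets of formulas, or intuitionistic, where the language has none of $\sim,\bot$ and the multiplicative disjunction, and every sequent has exactly one formula on the right. (This covers MLL, MALL, their affine versions, and their intuitionistic versions.) Sequent validity in $\mathsf{LOG}$ is the problem of deciding whether a given sequent of $\mathsf{LOG}$ is provable in the sequent calculus of $\mathsf{LOG}$. An individual resource game is a tuple $G=(N,\gamma_1,\dots,\gamma_n,\epsilon_1,\dots,\epsilon_n)$, where $N=\{1,\dots,n\}$ is a finite set of players, each goal $\gamma_i$ is a formula of $\mathsf{LOG}$ and each endowment $\epsilon_i$ is a finite multiset of formulas of $\mathsf{LOG}$. A profile is a tuple $P=(C_1,\dots,C_n)$ of multisets with $C_i\subseteq\epsilon_i$ for every $i$; its outcome is the multiset union $\mathsf{out}(P)=\biguplus_i C_i$. Player $i$ dichotomously strongly prefers $P$ over $Q$, written $Q\prec_i P$, iff $\mathsf{out}(P)\vdash\gamma_i$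 is provable in $\mathsf{LOG}$ and $\mathsf{out}(Q)\vdash\gamma_i$ is not. Consider the following decision problem: given an individual resource game $G$, two profiles $P,Q$ of $G$ and a player $i$ of $G$, does $Q\prec_i P$ hold? Proposition. 1. If sequent validity in $\mathsf{LOG}$ is $\mathsf{NP}$-complete, then this problem is $\mathsf{BH_2}$-complete, where $\mathsf{BH_2}=\mathsf{NP}\wedge\mathsf{coNP}=\{L_1\cap L_2 : L_1\in\mathsf{NP},\ L_2\in\mathsf{coNP}\}$. 2. If sequent validity in $\mathsf{LOG}$ is $\mathsf{PSPACE}$-complete, then this problem is $\mathsf{PSPACE}$-complete. Completeness is under polynomial-time many-one reductions. -/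

import Mathlib

/-! ## Formulas and sequents of (fragments of) propositional linear logic -/

/-- The connectives of multiplicative-additive linear logic:
`⊤, 0, 1, ⊥, ∼, ⅋, ⊗, ⊸, &, ⊕`. -/
inductive Conn : Type
  | top | zero | one | bot | neg | par | tensor | lolli | amp | plus

/-- Formulas. Atoms are named by binary words. -/
inductive Formula : Type
  | atom (name : List Bool)
  | top
  | zero
  | one
  | bot
  | neg (A : Formula)
  | par (A B : Formula)
  | tensor (A B : Formula)
  | lolli (A B : Formula)
  | amp (A B : Formula)
  | plus (A B : Formula)

/-- All connectives of the formula belong to `S`. -/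
def Formula.InLang (S : Set Conn) : Formula → Prop
  | atom _ => True
  | top => Conn.top ∈ S
  | zero => Conn.zero ∈ S
  | one => Conn.one ∈ S
  | bot => Conn.bot ∈ S
  | neg A => Conn.neg ∈ S ∧ A.InLang S
  | par A B => Conn.par ∈ S ∧ A.InLang S ∧ B.InLang S
  | tensor A B => Conn.tensor ∈ S ∧ A.InLang S ∧ B.InLang S
  | lolli A B => Conn.lolli ∈ S ∧ A.InLang S ∧ B.InLang S
  | amp A B => Conn.amp ∈ S ∧ A.InLang S ∧ B.InLang S
  | plus A B => Conn.plus ∈ S ∧ A.InLang S ∧ B.InLang S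

/-- A propositional variant of linear logic: a fragment of MALL that contains the
multiplicative core, with or without weakening, classical or intuitionistic.
The core is `1, ∼, ⊗, ⊸` in the classical case (the connectives `⊥` and `⅋` are
definable from it) and `1, ⊗, ⊸` in the intuitionistic case, where the connectives
`∼, ⊥, ⅋` are absent. -/
structure ResourceLogic where
  /-- the connectives of the language -/
  conn : Set Conn
  /-- the logic is affine: it has the rule of weakening -/
  affine : Prop
  /-- all sequents have exactly one formula on the right -/
  intuitionistic : Prop
  one_mem : Conn.one ∈ conn
  tensor_mem : Conn.tensor ∈ conn
  lolli_mem : Conn.lolli ∈ conn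
  neg_mem : ¬ intuitionistic → Conn.neg ∈ conn
  neg_notMem : intuitionistic → Conn.neg ∉ conn
  bot_notMem : intuitionistic → Conn.bot ∉ conn
  par_notMem : intuitionistic → Conn.par ∉ conn

namespace ResourceLogic

/-- (Affine, if `aff`) multiplicative linear logic. -/
def MLL (aff : Prop) : ResourceLogic where
  conn := {Conn.one, Conn.bot, Conn.neg, Conn.par, Conn.tensor, Conn.lolli}
  affine := aff
  intuitionistic := False
  one_mem := by simp
  tensor_mem := by simp
  lolli_mem := by simp
  neg_mem := by simp
  neg_notMem := by simp
  bot_notMem := by simp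
  par_notMem := by simp

/-- (Affine, if `aff`) multiplicative-additive linear logic. -/
def MALL (aff : Prop) : ResourceLogic where
  conn := Set.univ
  affine := aff
  intuitionistic := False
  one_mem := by simp
  tensor_mem := by simp
  lolli_mem := by simp
  neg_mem := by simp
  neg_notMem := by simp
  bot_notMem := by simp
  par_notMem := by simp

/-- (Affine, if `aff`) intuitionistic multiplicative linear logic. -/
def IMLL (aff : Prop) : ResourceLogic where
  conn := {Conn.one, Conn.tensor, Conn.lolli}
  affine := aff
  intuitionistic := True
  one_mem := by simp
  tensor_mem := by simp
  lolli_mem := by simp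
  neg_mem := by simp
  neg_notMem := by simp
  bot_notMem := by simp
  par_notMem := by simp

/-- (Affine, if `aff`) intuitionistic multiplicative-additive linear logic. -/
def IMALL (aff : Prop) : ResourceLogic where
  conn := {Conn.one, Conn.tensor, Conn.lolli, Conn.top, Conn.zero, Conn.amp, Conn.plus}
  affine := aff
  intuitionistic := True
  one_mem := by simp
  tensor_mem := by simp
  lolli_mem := by simp
  neg_mem := by simp
  neg_notMem := by simp
  bot_notMem := by simp
  par_notMem := by simp

/-- `Γ ⊢ Δ` is a sequent of the logic. -/
def IsSequent (L : ResourceLogic) (Γ Δ : Multiset Formula) : Prop :=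
  (∀ A ∈ Γ, A.InLang L.conn) ∧ (∀ A ∈ Δ, A.InLang L.conn) ∧
    (L.intuitionistic → Multiset.card Δ = 1)

/-- `L.Provable Γ Δ`: there is a proof of `Γ ⊢ Δ` in the logic `L`, that is, a proof by the
rules of the sequent calculus in which every sequent is a sequent of `L`, and in which weakening
is used only if `L` is affine. Exchange is built into the use of multisets. -/
inductive Provable (L : ResourceLogic) : Multiset Formula → Multiset Formula → Prop
  -- identities
  | ax (A : Formula) (hs : L.IsSequent {A} {A}) : Provable L {A} {A}
  | cut (Γ Γ' Δ Δ' : Multiset Formula) (A : Formula) (hs : L.IsSequent (Γ + Γ') (Δ + Δ'))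
      (h₁ : Provable L (A ::ₘ Γ) Δ) (h₂ : Provable L Γ' (A ::ₘ Δ')) :
      Provable L (Γ + Γ') (Δ + Δ')
  -- weakening
  | weakL (Γ Δ : Multiset Formula) (A : Formula) (haff : L.affine)
      (hs : L.IsSequent (A ::ₘ Γ) Δ) (h : Provable L Γ Δ) : Provable L (A ::ₘ Γ) Δ
  | weakR (Γ Δ : Multiset Formula) (A : Formula) (haff : L.affine)
      (hs : L.IsSequent Γ (A ::ₘ Δ)) (h : Provable L Γ Δ) : Provable L Γ (A ::ₘ Δ)
  -- negation
  | negL (Γ Δ : Multiset Formula) (A : Formula) (hs : L.IsSequent (A.neg ::ₘ Γ) Δ)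
      (h : Provable L Γ (A ::ₘ Δ)) : Provable L (A.neg ::ₘ Γ) Δ
  | negR (Γ Δ : Multiset Formula) (A : Formula) (hs : L.IsSequent Γ (A.neg ::ₘ Δ))
      (h : Provable L (A ::ₘ Γ) Δ) : Provable L Γ (A.neg ::ₘ Δ)
  -- multiplicatives
  | tensorR (Γ Γ' Δ Δ' : Multiset Formula) (A B : Formula)
      (hs : L.IsSequent (Γ + Γ') (A.tensor B ::ₘ (Δ + Δ')))
      (h₁ : Provable L Γ (A ::ₘ Δ)) (h₂ : Provable L Γ' (B ::ₘ Δ')) :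
      Provable L (Γ + Γ') (A.tensor B ::ₘ (Δ + Δ'))
  | tensorL (Γ Δ : Multiset Formula) (A B : Formula) (hs : L.IsSequent (A.tensor B ::ₘ Γ) Δ)
      (h : Provable L (A ::ₘ B ::ₘ Γ) Δ) : Provable L (A.tensor B ::ₘ Γ) Δ
  | parL (Γ Γ' Δ Δ' : Multiset Formula) (A B : Formula)
      (hs : L.IsSequent (A.par B ::ₘ (Γ + Γ')) (Δ + Δ'))
      (h₁ : Provable L (A ::ₘ Γ) Δ) (h₂ : Provable L (B ::ₘ Γ') Δ') :
      Provable L (A.par B ::ₘ (Γ + Γ')) (Δ + Δ')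
  | parR (Γ Δ : Multiset Formula) (A B : Formula) (hs : L.IsSequent Γ (A.par B ::ₘ Δ))
      (h : Provable L Γ (A ::ₘ B ::ₘ Δ)) : Provable L Γ (A.par B ::ₘ Δ)
  | lolliL (Γ Γ' Δ Δ' : Multiset Formula) (A B : Formula)
      (hs : L.IsSequent (A.lolli B ::ₘ (Γ + Γ')) (Δ + Δ'))
      (h₁ : Provable L Γ (A ::ₘ Δ)) (h₂ : Provable L (B ::ₘ Γ') Δ') :
      Provable L (A.lolli B ::ₘ (Γ + Γ')) (Δ + Δ')
  | lolliR (Γ Δ : Multiset Formula) (A B : Formula) (hs : L.IsSequent Γ (A.lolli B ::ₘ Δ))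
      (h : Provable L (A ::ₘ Γ) (B ::ₘ Δ)) : Provable L Γ (A.lolli B ::ₘ Δ)
  | oneL (Γ Δ : Multiset Formula) (hs : L.IsSequent (Formula.one ::ₘ Γ) Δ)
      (h : Provable L Γ Δ) : Provable L (Formula.one ::ₘ Γ) Δ
  | oneR (hs : L.IsSequent 0 {Formula.one}) : Provable L 0 {Formula.one}
  | botL (hs : L.IsSequent {Formula.bot} 0) : Provable L {Formula.bot} 0
  | botR (Γ Δ : Multiset Formula) (hs : L.IsSequent Γ (Formula.bot ::ₘ Δ))
      (h : Provable L Γ Δ) : Provable L Γ (Formula.bot ::ₘ Δ)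
  -- additives
  | ampR (Γ Δ : Multiset Formula) (A B : Formula) (hs : L.IsSequent Γ (A.amp B ::ₘ Δ))
      (h₁ : Provable L Γ (A ::ₘ Δ)) (h₂ : Provable L Γ (B ::ₘ Δ)) :
      Provable L Γ (A.amp B ::ₘ Δ)
  | ampL₀ (Γ Δ : Multiset Formula) (A B : Formula) (hs : L.IsSequent (A.amp B ::ₘ Γ) Δ)
      (h : Provable L (A ::ₘ Γ) Δ) : Provable L (A.amp B ::ₘ Γ) Δ
  | ampL₁ (Γ Δ : Multiset Formula) (A B : Formula) (hs : L.IsSequent (A.amp B ::ₘ Γ) Δ)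
      (h : Provable L (B ::ₘ Γ) Δ) : Provable L (A.amp B ::ₘ Γ) Δ
  | plusL (Γ Δ : Multiset Formula) (A B : Formula) (hs : L.IsSequent (A.plus B ::ₘ Γ) Δ)
      (h₁ : Provable L (A ::ₘ Γ) Δ) (h₂ : Provable L (B ::ₘ Γ) Δ) :
      Provable L (A.plus B ::ₘ Γ) Δ
  | plusR₀ (Γ Δ : Multiset Formula) (A B : Formula) (hs : L.IsSequent Γ (A.plus B ::ₘ Δ))
      (h : Provable L Γ (A ::ₘ Δ)) : Provable L Γ (A.plus B ::ₘ Δ)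
  | plusR₁ (Γ Δ : Multiset Formula) (A B : Formula) (hs : L.IsSequent Γ (A.plus B ::ₘ Δ))
      (h : Provable L Γ (B ::ₘ Δ)) : Provable L Γ (A.plus B ::ₘ Δ)
  | topR (Γ Δ : Multiset Formula) (hs : L.IsSequent Γ (Formula.top ::ₘ Δ)) :
      Provable L Γ (Formula.top ::ₘ Δ)
  | zeroL (Γ Δ : Multiset Formula) (hs : L.IsSequent (Formula.zero ::ₘ Γ) Δ) :
      Provable L (Formula.zero ::ₘ Γ) Δ

end ResourceLogic

/-! ## Individual resource games and dichotomous preferences -/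

/-- An individual resource game over the logic `L`, with players `0, …, n - 1`. -/
structure ResourceGame (L : ResourceLogic) where
  n : ℕ
  goal : Fin n → Formula
  endow : Fin n → Multiset Formula
  goal_inLang : ∀ i, (goal i).InLang L.conn
  endow_inLang : ∀ i, ∀ A ∈ endow i, A.InLang L.conn

namespace ResourceGame

variable {L : ResourceLogic}

/-- The possible actions of player `i`: the multisets contained in the endowment of `i`. -/
def Action (G : ResourceGame L) (i : Fin G.n) : Type :=
  {C : Multiset Formula // C ≤ G.endow i}

/-- The profiles of `G`. -/
def Profile (G : ResourceGame L) : Type := (i : Fin G.n) → G.Action i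

/-- The outcome of a profile: the multiset union of the contributions of the players. -/
def outcome (G : ResourceGame L) (P : G.Profile) : Multiset Formula := ∑ i, (P i).1

/-- Player `i` dichotomously strongly prefers `P` over `Q`. -/
def StronglyPrefers (G : ResourceGame L) (i : Fin G.n) (P Q : G.Profile) : Prop :=
  L.Provable (G.outcome P) {G.goal i} ∧ ¬ L.Provable (G.outcome Q) {G.goal i}

end ResourceGame

/-! ## The two decision problems as languages -/

/-- The finite alphabet in which sequents and games are written. -/
inductive Token : Type
  | conn (c : Conn)
  | atom
  | bit (b : Bool)
  | comma
  | turnstile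
  | tick
  | player
  | item (inP inQ : Bool)

/-- Formulas are written in Polish (prefix) notation; an atom is the token `atom` followed
by its name. -/
def Formula.code : Formula → List Token
  | atom w => Token.atom :: w.map Token.bit
  | top => [Token.conn Conn.top]
  | zero => [Token.conn Conn.zero]
  | one => [Token.conn Conn.one]
  | bot => [Token.conn Conn.bot]
  | neg A => Token.conn Conn.neg :: A.code
  | par A B => Token.conn Conn.par :: (A.code ++ B.code)
  | tensor A B => Token.conn Conn.tensor :: (A.code ++ B.code)
  | lolli A B => Token.conn Conn.lolli :: (A.code ++ B.code)
  | amp A B => Token.conn Conn.amp :: (A.code ++ B.code)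
  | plus A B => Token.conn Conn.plus :: (A.code ++ B.code)

/-- The code of a sequent whose two sides are listed as `Γ` and `Δ`. -/
def sequentCode (Γ Δ : List Formula) : List Token :=
  Γ.flatMap (fun A => Token.comma :: A.code) ++
    Token.turnstile :: Δ.flatMap (fun A => Token.comma :: A.code)

/-- The problem of sequent validity in `L`: given a sequent, is it provable in `L`? -/
def sequentValidity (L : ResourceLogic) : Language Token :=
  {w | ∃ Γ Δ : List Formula, w = sequentCode Γ Δ ∧
    L.Provable (Γ : Multiset Formula) (Δ : Multiset Formula)}

/-- One resource of an endowment, with two marks saying whether this occurrence is contributed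
in the first, respectively in the second, profile. -/
structure MarkedResource where
  res : Formula
  inP : Bool
  inQ : Bool

/-- The code of one player: the goal, followed by the marked resources of the endowment. -/
def playerCode (γ : Formula) (l : List MarkedResource) : List Token :=
  Token.player :: (γ.code ++ l.flatMap (fun r => Token.item r.inP r.inQ :: r.res.code))

/-- The word `w` is a code of the instance `(G, P, Q, i)`. The number `i` is written in unary, and
then the players are written one after the other. The endowment of each player is given by a list
of its resources, and the actions of the player in `P` and in `Q` by the marks on this list. -/
def IsInstanceCode {L : ResourceLogic} (G : ResourceGame L) (P Q : G.Profile) (i : Fin G.n)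
    (w : List Token) : Prop :=
  ∃ l : Fin G.n → List MarkedResource,
    (∀ j, ((l j).map MarkedResource.res : Multiset Formula) = G.endow j ∧
      (((l j).filter MarkedResource.inP).map MarkedResource.res : Multiset Formula) = (P j).1 ∧
      (((l j).filter MarkedResource.inQ).map MarkedResource.res : Multiset Formula) = (Q j).1) ∧
    w = List.replicate i Token.tick ++
      (List.ofFn fun j => playerCode (G.goal j) (l j)).flatten

/-- The problem of dichotomous strong preference: given a game `G`, two profiles `P` and `Q`
and a player `i`, does `i` dichotomously strongly prefer `P` over `Q`? -/
def dichotomousPreference (L : ResourceLogic) : Language Token :=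
  {w | ∃ (G : ResourceGame L) (P Q : G.Profile) (i : Fin G.n),
    IsInstanceCode G P Q i w ∧ G.StronglyPrefers i P Q}

/-! ## Machines and complexity classes -/

/-- A nondeterministic Turing machine with finitely many stacks in place of tapes (two stacks make
up a tape), with inputs over the alphabet `α`. In one step the machine reads the
state and the top symbols of all stacks (`none` for an empty stack), moves to a new state and
replaces the top symbol of every stack by a word. -/
structure Machine (α : Type) where
  State : Type
  Stack : Type
  Sym : Type
  [finState : Finite State]
  [finStack : Finite Stack]
  [finSym : Finite Sym]
  /-- the input alphabet is part of the alphabet of the machine -/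
  input : α ↪ Sym
  inStack : Stack
  outStack : Stack
  start : State
  accept : Set State
  next : State → (Stack → Option Sym) → Set (State × (Stack → List Sym))
  next_finite : ∀ q t, (next q t).Finite

namespace Machine

variable {α : Type}

/-- Configurations; the head of a list is the top of the stack. -/
structure Config (M : Machine α) where
  state : M.State
  stack : M.Stack → List M.Sym

/-- The moves that are possible in a configuration. -/
def moves (M : Machine α) (c : M.Config) : Set (M.State × (M.Stack → List M.Sym)) :=
  M.next c.state (fun j => (c.stack j).head?)

/-- `c'` is a successor of `c`. -/
def Step (M : Machine α) (c c' : M.Config) : Prop :=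
  ∃ m ∈ M.moves c, c'.state = m.1 ∧ ∀ j, c'.stack j = m.2 j ++ (c.stack j).tail

/-- `M.Run k c c'`: some computation of exactly `k` steps leads from `c` to `c'`. -/
inductive Run (M : Machine α) : ℕ → M.Config → M.Config → Prop
  | refl (c : M.Config) : Run M 0 c c
  | step {k : ℕ} {c c' c'' : M.Config} (h : M.Step c c') (h' : Run M k c' c'') :
      Run M (k + 1) c c''

open Classical in
/-- The initial configuration: the input is on the input stack, first symbol on top, and the
other stacks are empty. -/
noncomputable def init (M : Machine α) (w : List α) : M.Config where
  state := M.start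
  stack := fun j => if j = M.inStack then w.map M.input else []

/-- No move is possible. -/
def Halted (M : Machine α) (c : M.Config) : Prop := M.moves c = ∅

/-- Some computation on input `w` halts in an accepting state. -/
def Accepts (M : Machine α) (w : List α) : Prop :=
  ∃ k c, M.Run k (M.init w) c ∧ M.Halted c ∧ c.state ∈ M.accept

/-- In every situation there is at most one move. -/
def Deterministic (M : Machine α) : Prop := ∀ q t, (M.next q t).Subsingleton

/-- No computation on an input of length `n` has more than `p n` steps. -/
def RunsInTime (M : Machine α) (p : Polynomial ℕ) : Prop :=
  ∀ w k c, M.Run k (M.init w) c → k ≤ p.eval w.length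

/-- In the computations on an input of length `n`, no stack ever holds more than `p n` symbols. -/
def RunsInSpace (M : Machine α) (p : Polynomial ℕ) : Prop :=
  ∀ w k c, M.Run k (M.init w) c → ∀ j, (c.stack j).length ≤ p.eval w.length

/-- On every input some computation (the only one, if `M` is deterministic) halts. -/
def Halts (M : Machine α) : Prop := ∀ w, ∃ k c, M.Run k (M.init w) c ∧ M.Halted c

end Machine

/-- `f` is computed by a deterministic machine in polynomial time. -/
def PolyTimeComputable {α β : Type} (f : List α → List β) : Prop :=
  ∃ (M : Machine α) (output : β ↪ M.Sym) (p : Polynomial ℕ),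
    M.Deterministic ∧ M.RunsInTime p ∧
      ∀ w, ∃ k c, M.Run k (M.init w) c ∧ M.Halted c ∧ c.stack M.outStack = (f w).map output

/-- Polynomial-time many-one reducibility. -/
def PolyReduces {α β : Type} (A : Language α) (B : Language β) : Prop :=
  ∃ f : List α → List β, PolyTimeComputable f ∧ ∀ w, w ∈ A ↔ f w ∈ B

/-- A complexity class: a set of languages over every alphabet. -/
def ComplexityClass : Type 1 := (α : Type) → Set (Language α)

namespace ComplexityClass

/-- The languages recognised by nondeterministic machines in polynomial time. -/
def NP : ComplexityClass := fun _ =>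
  {A | ∃ (M : Machine _) (p : Polynomial ℕ), M.RunsInTime p ∧ ∀ w, w ∈ A ↔ M.Accepts w}

/-- The languages decided by deterministic machines in polynomial space. -/
def PSPACE : ComplexityClass := fun _ =>
  {A | ∃ (M : Machine _) (p : Polynomial ℕ), M.Deterministic ∧ M.RunsInSpace p ∧ M.Halts ∧
    ∀ w, w ∈ A ↔ M.Accepts w}

/-- The complements of the languages in the class. -/
def co (C : ComplexityClass) : ComplexityClass := fun _ => {A | Aᶜ ∈ C _}

/-- The intersections of a language in `C₁` with a language in `C₂`. -/
def meet (C₁ C₂ : ComplexityClass) : ComplexityClass := fun _ =>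
  {A | ∃ A₁ ∈ C₁ _, ∃ A₂ ∈ C₂ _, A = A₁ ⊓ A₂}

/-- The second level `NP ∧ coNP` of the Boolean hierarchy over `NP`. -/
def BH₂ : ComplexityClass := NP.meet NP.co

/-- `A` is complete for `C` under polynomial-time many-one reductions. -/
def Complete (C : ComplexityClass) {α : Type} (A : Language α) : Prop :=
  A ∈ C α ∧ ∀ (β : Type) [Finite β] (B : Language β), B ∈ C β → PolyReduces B A

end ComplexityClass

/-! Let V be sequent validity. Membership: from a well-formed instance a polynomial-time function
computes the sequent `out(P) ⊢ γ_i`, and another one computes `out(Q) ⊢ γ_i`. Hence the preference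
problem is f⁻¹(V) ∩ (g⁻¹(V))ᶜ (`ComplexityClass.dichotomousPreference_eq`). NP is closed under
preimages of polynomial-time functions, which gives BH₂; PSPACE is moreover closed under complement
and intersection. Words that code no instance are sent to the empty word, which is not a valid
sequent.

Hardness: let A and the complement of A' lie in a class for which V is complete. Reductions to V
turn an input into two words, and the input lies in A ∩ A' exactly when the first is a valid sequent
and the second is not. By currying, and by negating the right side in the classical case, a sequent
becomes a formula F that is provable iff the sequent is (`provable_sequentFormula_iff`). Let F° be F
with atoms renamed apart from an atom p. Then `F° ⊸ p ⊢ p` holds iff `⊢ F` does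
(`provable_rename_lolli_iff`): substitute F for p and undo the renaming, then cut against `⊢ F ⊸ F`.
Two players with goal p, the first contributing its implication only in P and the second only in Q,
form the required game (`append_mem_dichotomousPreference_iff`). Degenerate inputs leave an outcome
empty, and `⊢ p` is refuted by a two-valued model. Cut elimination is never needed. With A = A' = B
the same reduction gives PSPACE-hardness.

For the machines, programs are assembled from fragments by sequential composition, by embedding into
more stacks and symbols, and by loops over one stack. All concrete translations are finite
transducers run on words that a one-counter check has recognised as sequences of blocks. Polish
notation read from right to left presents the arguments before their connective, so counting the
pending formulas is enough. -/

/-! ## Fragments of machines -/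

/-- A machine without input and output conventions, working on the stacks `K` with symbols `S`. -/
structure Frag (K S : Type) where
  State : Type
  finState : Finite State
  start : State
  next : State → (K → Option S) → Set (State × (K → List S))
  next_finite : ∀ q t, (next q t).Finite

namespace Frag

variable {K S : Type}

/-- The top symbols of the stacks. -/
def tops (s : K → List S) : K → Option S := fun k => (s k).head?

/-- One step of a fragment. -/
def Step (F : Frag K S) (c c' : F.State × (K → List S)) : Prop :=
  ∃ m ∈ F.next c.1 (tops c.2), c'.1 = m.1 ∧ ∀ k, c'.2 k = m.2 k ++ (c.2 k).tail

/-- Computations of a given number of steps. -/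
inductive Run (F : Frag K S) :
    ℕ → F.State × (K → List S) → F.State × (K → List S) → Prop
  | refl (c) : Run F 0 c c
  | step {k c c' c''} (h : F.Step c c') (h' : Run F k c' c'') : Run F (k + 1) c c''

/-- No move is possible. -/
def Halted (F : Frag K S) (c : F.State × (K → List S)) : Prop := F.next c.1 (tops c.2) = ∅

/-- There is at most one move in every situation. -/
def Det (F : Frag K S) : Prop := ∀ q t, (F.next q t).Subsingleton

/-- Started on the stacks `s`, some computation of at most `T` steps halts in `q` with `s'`. -/
def HaltsIn (F : Frag K S) (T : ℕ) (s : K → List S) (q : F.State) (s' : K → List S) : Prop :=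
  ∃ t ≤ T, F.Run t (F.start, s) (q, s') ∧ F.Halted (q, s')

theorem HaltsIn.mono {F : Frag K S} {T T' : ℕ} {s s' : K → List S} {q : F.State}
    (h : F.HaltsIn T s q s') (hT : T ≤ T') : F.HaltsIn T' s q s' := by
  obtain ⟨t, ht, h⟩ := h
  exact ⟨t, ht.trans hT, h⟩

theorem Run.trans {F : Frag K S} {k j : ℕ} {c d e} (h : F.Run k c d) (h' : F.Run j d e) :
    F.Run (k + j) c e := by
  induction h with
  | refl c => simpa using h'
  | @step k c c' c'' h _ ih =>
    have := Run.step h (ih h')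
    rwa [show k + 1 + j = k + j + 1 by omega]

theorem step_iff_of_halted {F : Frag K S} {c d} (h : F.Halted c) : ¬ F.Step c d := by
  rintro ⟨m, hm, -⟩
  rw [Halted] at h
  simp [h] at hm

theorem Det.step_unique {F : Frag K S} (hF : F.Det) {c d d'} (h : F.Step c d)
    (h' : F.Step c d') : d = d' := by
  obtain ⟨m, hm, h1, h2⟩ := h
  obtain ⟨m', hm', h1', h2'⟩ := h'
  obtain rfl := hF _ _ hm hm'
  refine Prod.ext (h1.trans h1'.symm) (funext fun k => ?_)
  rw [h2, h2']

/-- Only one path starts at `c`, so every run from `c` is an initial segment of the halting one and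
can itself halt only at the end of it. One halting run thus bounds all runs. -/
theorem Det.run_le {F : Frag K S} (hF : F.Det) {k c d} (h : F.Run k c d) (hd : F.Halted d) :
    ∀ {j e}, F.Run j c e → j ≤ k ∧ (F.Halted e → j = k ∧ e = d) := by
  induction h with
  | refl c =>
    intro j e h
    cases h with
    | refl => simp
    | step h _ => exact (step_iff_of_halted hd h).elim
  | step h _ ih =>
    intro j e h'
    cases h' with
    | refl => exact ⟨by omega, fun he => (step_iff_of_halted he h).elim⟩
    | step h₁ h₂ =>
      obtain rfl := hF.step_unique h h₁
      obtain ⟨h3, h4⟩ := ih hd h₂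
      exact ⟨by omega, fun he => by simpa using h4 he⟩

theorem Det.haltsIn {F : Frag K S} (hF : F.Det) {T s q s'} (h : F.HaltsIn T s q s') {j e}
    (hr : F.Run j (F.start, s) e) : j ≤ T ∧ (F.Halted e → e = (q, s')) := by
  obtain ⟨t, ht, h1, h2⟩ := h
  obtain ⟨h3, h4⟩ := hF.run_le h1 h2 hr
  exact ⟨h3.trans ht, fun he => (h4 he).2⟩

/-- The stacks grow by at most a constant in each step. -/
theorem exists_growth [Finite K] [Finite S] (F : Frag K S) :
    ∃ b : ℕ, ∀ {k c d}, F.Run k c d → ∀ j, (d.2 j).length ≤ (c.2 j).length + b * k := by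
  have := F.finState
  -- There are finitely many moves in all, so the words they push have a greatest length `b`.
  have hfin : (⋃ q, ⋃ t, F.next q t).Finite :=
    Set.finite_iUnion fun q => Set.finite_iUnion fun t => F.next_finite q t
  have hfin2 : ((fun x : (F.State × (K → List S)) × K => (x.1.2 x.2).length) ''
      ((⋃ q, ⋃ t, F.next q t) ×ˢ (Set.univ : Set K))).Finite :=
    (hfin.prod Set.finite_univ).image _
  obtain ⟨b, hb⟩ := hfin2.bddAbove
  refine ⟨b, fun {k c d} h => ?_⟩
  induction h with
  | refl => simp
  | @step k c c' c'' h _ ih =>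
    intro j
    obtain ⟨m, hm, -, h2⟩ := h
    have h3 : (m.2 j).length ≤ b := hb ⟨(m, j), ⟨by
      simp only [Set.mem_iUnion]
      exact ⟨_, _, hm⟩, trivial⟩, rfl⟩
    have h4 := ih j
    rw [h2, List.length_append, List.length_tail] at h4
    rw [mul_add]
    omega

/-! ### Sequential composition -/

/-- Run `F`; when it halts in a state of `A`, continue with `G` on the same stacks. -/
def seq (F : Frag K S) (A : Set F.State) (G : Frag K S) : Frag K S where
  State := F.State ⊕ G.State
  finState := by
    have := F.finState
    have := G.finState
    infer_instance
  start := Sum.inl F.start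
  next q t := match q with
    | Sum.inl q => (fun m => (Sum.inl m.1, m.2)) '' F.next q t ∪
        -- The handover is a step of its own, possible only where `F` is stuck. A step always
        -- removes the tops, so pushing them back leaves the stacks unchanged.
        {m | F.next q t = ∅ ∧ q ∈ A ∧ m = (Sum.inr G.start, fun k => (t k).toList)}
    | Sum.inr q => (fun m => (Sum.inr m.1, m.2)) '' G.next q t
  next_finite q t := by
    cases q with
    | inl q =>
      refine ((F.next_finite q t).image _).union ?_
      exact (Set.finite_singleton (Sum.inr G.start, fun k => (t k).toList)).subset
        fun m hm => hm.2.2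
    | inr q => exact (G.next_finite q t).image _

variable {F G : Frag K S} {A : Set F.State}

theorem Det.seq (hF : F.Det) (hG : G.Det) : (F.seq A G).Det := by
  rintro (q | q) t
  · rintro m (⟨a, ha, rfl⟩ | ⟨h1, -, rfl⟩) m' (⟨a', ha', rfl⟩ | ⟨h1', -, rfl⟩)
    · rw [hF q t ha ha']
    · simp [h1'] at ha
    · simp [h1] at ha'
    · rfl
  · rintro m ⟨a, ha, rfl⟩ m' ⟨a', ha', rfl⟩
    rw [hG q t ha ha']

theorem toList_head?_append_tail {β : Type} (l : List β) : l.head?.toList ++ l.tail = l := by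
  cases l <;> simp

theorem halted_seq_inl {q s} :
    (F.seq A G).Halted (Sum.inl q, s) ↔ F.Halted (q, s) ∧ q ∉ A := by
  have : (F.seq A G).next (Sum.inl q) (tops s) = ∅ ↔ F.next q (tops s) = ∅ ∧
      {m : (F.State ⊕ G.State) × (K → List S) | F.next q (tops s) = ∅ ∧ q ∈ A ∧
        m = (Sum.inr G.start, fun k => (tops s k).toList)} = ∅ := by
    exact Set.union_empty_iff.trans (and_congr_left fun _ => Set.image_eq_empty)
  refine this.trans ?_
  constructor
  · rintro ⟨h1, h2⟩
    refine ⟨h1, fun hq => ?_⟩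
    exact Set.eq_empty_iff_forall_notMem.1 h2 _ ⟨h1, hq, rfl⟩
  · rintro ⟨h1, h2⟩
    exact ⟨h1, Set.eq_empty_iff_forall_notMem.2 fun m hm => h2 hm.2.1⟩

theorem halted_seq_inr {q s} : (F.seq A G).Halted (Sum.inr q, s) ↔ G.Halted (q, s) := by
  exact Set.image_eq_empty

theorem step_seq_inl {q s x} (h : (F.seq A G).Step (Sum.inl q, s) x) :
    (∃ d, F.Step (q, s) d ∧ x = (Sum.inl d.1, d.2)) ∨
      (F.Halted (q, s) ∧ q ∈ A ∧ x = (Sum.inr G.start, s)) := by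
  obtain ⟨m, ⟨a, ha, rfl⟩ | ⟨h1, h2, rfl⟩, hm1, hm2⟩ := h
  · exact Or.inl ⟨(a.1, x.2), ⟨a, ha, rfl, hm2⟩, Prod.ext hm1 rfl⟩
  · refine Or.inr ⟨h1, h2, Prod.ext hm1 (funext fun k => ?_)⟩
    rw [hm2]
    exact toList_head?_append_tail _

theorem step_seq_inr {q s x} (h : (F.seq A G).Step (Sum.inr q, s) x) :
    ∃ d, G.Step (q, s) d ∧ x = (Sum.inr d.1, d.2) := by
  obtain ⟨m, ⟨a, ha, rfl⟩, hm1, hm2⟩ := h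
  exact ⟨(a.1, x.2), ⟨a, ha, rfl, hm2⟩, Prod.ext hm1 rfl⟩

theorem Run.seq_inl {k c d} (h : F.Run k c d) :
    (F.seq A G).Run k (Sum.inl c.1, c.2) (Sum.inl d.1, d.2) := by
  induction h with
  | refl => exact .refl _
  | step h _ ih =>
    obtain ⟨m, hm, h1, h2⟩ := h
    exact .step ⟨(Sum.inl m.1, m.2), Or.inl ⟨m, hm, rfl⟩, congrArg Sum.inl h1, h2⟩ ih

theorem Run.seq_inr {k c d} (h : G.Run k c d) :
    (F.seq A G).Run k (Sum.inr c.1, c.2) (Sum.inr d.1, d.2) := by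
  induction h with
  | refl => exact .refl _
  | step h _ ih =>
    obtain ⟨m, hm, h1, h2⟩ := h
    exact .step ⟨(Sum.inr m.1, m.2), ⟨m, hm, rfl⟩, congrArg Sum.inr h1, h2⟩ ih

theorem Run.seq {k c q s j e} (h : F.Run k c (q, s)) (hh : F.Halted (q, s)) (hA : q ∈ A)
    (h' : G.Run j (G.start, s) e) :
    (F.seq A G).Run (k + 1 + j) (Sum.inl c.1, c.2) (Sum.inr e.1, e.2) := by
  have h1 : (F.seq A G).Step (Sum.inl q, s) (Sum.inr G.start, s) :=
    ⟨(Sum.inr G.start, fun k => (tops s k).toList), Or.inr ⟨hh, hA, rfl⟩, rfl,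
      fun k => (toList_head?_append_tail _).symm⟩
  rw [add_assoc, add_comm 1 j]
  exact h.seq_inl.trans (.step h1 h'.seq_inr)

theorem run_seq_inr {k x y} (h : (F.seq A G).Run k x y) {c : G.State × (K → List S)}
    (hx : x = (Sum.inr c.1, c.2)) : ∃ d, G.Run k c d ∧ y = (Sum.inr d.1, d.2) := by
  induction h generalizing c with
  | refl => exact ⟨c, .refl _, hx⟩
  | step h _ ih =>
    subst hx
    obtain ⟨d, hd, rfl⟩ := step_seq_inr h
    obtain ⟨e, he, rfl⟩ := ih rfl
    exact ⟨e, .step hd he, rfl⟩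

/-- A computation of a sequential composition is a computation of the first part, or a halting
computation of the first part followed by a computation of the second part. -/
theorem run_seq {k x y} (h : (F.seq A G).Run k x y) {c : F.State × (K → List S)}
    (hx : x = (Sum.inl c.1, c.2)) :
    (∃ d, F.Run k c d ∧ y = (Sum.inl d.1, d.2)) ∨
      ∃ i d j e, F.Run i c d ∧ F.Halted d ∧ d.1 ∈ A ∧ G.Run j (G.start, d.2) e ∧
        y = (Sum.inr e.1, e.2) ∧ k = i + 1 + j := by
  induction h generalizing c with
  | refl => exact Or.inl ⟨c, .refl _, hx⟩
  | step h h' ih =>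
    subst hx
    rcases step_seq_inl h with ⟨d, hd, rfl⟩ | ⟨h1, h2, rfl⟩
    · rcases ih rfl with ⟨e, he, rfl⟩ | ⟨i, d', j, e, h1, h2, h3, h4, rfl, rfl⟩
      · exact Or.inl ⟨e, .step hd he, rfl⟩
      · exact Or.inr ⟨i + 1, d', j, e, .step hd h1, h2, h3, h4, rfl, by omega⟩
    · obtain ⟨e, he, rfl⟩ := run_seq_inr h' (c := (G.start, c.2)) rfl
      exact Or.inr ⟨0, c, _, e, .refl _, h1, h2, he, rfl, by omega⟩

theorem HaltsIn.seq {T T' s q s' q' s''} (h : F.HaltsIn T s q s') (hq : q ∈ A)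
    (h' : G.HaltsIn T' s' q' s'') :
    (F.seq A G).HaltsIn (T + 1 + T') s (Sum.inr q') s'' := by
  obtain ⟨t, ht, h1, h2⟩ := h
  obtain ⟨t', ht', h1', h2'⟩ := h'
  exact ⟨t + 1 + t', by omega, h1.seq h2 hq h1', halted_seq_inr.2 h2'⟩

theorem HaltsIn.seq_of_notMem {T s q s'} (h : F.HaltsIn T s q s') (hq : q ∉ A) :
    (F.seq A G).HaltsIn T s (Sum.inl q) s' := by
  obtain ⟨t, ht, h1, h2⟩ := h
  exact ⟨t, by omega, h1.seq_inl, halted_seq_inl.2 ⟨h2, hq⟩⟩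

/-! ### More stacks and symbols -/

section Lift

variable {K' S' : Type} (eK : K ↪ K') (eS : S ↪ S')

/-- The fragment `F` working on some of the stacks `K'` with some of the symbols `S'`. -/
def lift (F : Frag K S) : Frag K' S' where
  State := F.State
  finState := F.finState
  start := F.start
  -- There is no move when a foreign symbol lies on top of an embedded stack. The stacks outside the
  -- range of `eK` get their top back.
  next q t := {m | ∃ t₀ : K → Option S, (∀ j, t (eK j) = (t₀ j).map eS) ∧
    ∃ m₀ ∈ F.next q t₀, m.1 = m₀.1 ∧ (∀ j, m.2 (eK j) = (m₀.2 j).map eS) ∧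
      ∀ k, k ∉ Set.range eK → m.2 k = (t k).toList}
  next_finite q t := by
    classical
    by_cases h : ∃ t₀ : K → Option S, ∀ j, t (eK j) = (t₀ j).map eS
    · obtain ⟨t₀, ht₀⟩ := h
      -- A move is determined by its state and its words on the embedded stacks, because the other
      -- words are forced by `t`.
      refine Set.Finite.of_finite_image (f := fun m => (m.1, fun j => m.2 (eK j))) ?_ ?_
      · refine ((F.next_finite q t₀).image (fun m => (m.1, fun j => (m.2 j).map eS))).subset ?_
        rintro _ ⟨m, ⟨t₁, ht₁, m₀, hm₀, h1, h2, -⟩, rfl⟩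
        have : t₁ = t₀ := funext fun j =>
          Option.map_injective eS.injective ((ht₁ j).symm.trans (ht₀ j))
        subst this
        exact ⟨m₀, hm₀, Prod.ext h1.symm (funext fun j => (h2 j).symm)⟩
      · rintro m ⟨-, -, -, -, -, -, h1⟩ m' ⟨-, -, -, -, -, -, h2⟩ h
        simp only [Prod.mk.injEq] at h
        refine Prod.ext h.1 (funext fun k => ?_)
        by_cases hk : k ∈ Set.range eK
        · obtain ⟨j, rfl⟩ := hk
          exact congrFun h.2 j
        · rw [h1 k hk, h2 k hk]
    · convert Set.finite_empty
      exact Set.eq_empty_iff_forall_notMem.2 fun m ⟨t₀, ht₀, _⟩ => h ⟨t₀, ht₀⟩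

/-- The stacks `σ` hold the stacks `s` of the embedded fragment, and agree with `σ₀` elsewhere. -/
def Holds (σ₀ : K' → List S') (s : K → List S) (σ : K' → List S') : Prop :=
  (∀ j, σ (eK j) = (s j).map eS) ∧ ∀ k, k ∉ Set.range eK → σ k = σ₀ k

variable {eK eS}

theorem Holds.tops {σ₀ s σ} (h : Holds eK eS σ₀ s σ) (j : K) :
    Frag.tops σ (eK j) = (Frag.tops s j).map eS := by
  simp [Frag.tops, h.1]

theorem Det.lift (hF : F.Det) : (F.lift eK eS).Det := by
  rintro q t m ⟨t₀, ht₀, a, ha, h1, h2, h3⟩ m' ⟨t₁, ht₁, b, hb, h1', h2', h3'⟩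
  have : t₁ = t₀ := funext fun j =>
    Option.map_injective eS.injective ((ht₁ j).symm.trans (ht₀ j))
  subst this
  obtain rfl := hF q t₁ ha hb
  refine Prod.ext (h1.trans h1'.symm) (funext fun k => ?_)
  by_cases hk : k ∈ Set.range eK
  · obtain ⟨j, rfl⟩ := hk
    rw [h2, h2']
  · rw [h3 k hk, h3' k hk]

theorem halted_lift {σ₀ s σ q} (h : Holds eK eS σ₀ s σ) :
    (F.lift eK eS).Halted (q, σ) ↔ F.Halted (q, s) := by
  classical
  simp only [Halted, Set.eq_empty_iff_forall_notMem]
  constructor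
  · intro h1 m hm
    refine h1 (m.1, fun k => if hk : k ∈ Set.range eK then (m.2 hk.choose).map eS
      else (tops σ k).toList) ⟨tops s, h.tops, m, hm, rfl, fun j => ?_, fun k hk => ?_⟩
    · have hj : eK j ∈ Set.range eK := ⟨j, rfl⟩
      have := eK.injective hj.choose_spec
      simp only [hj, dite_true]
      rw [this]
    · simp only [hk, dite_false]
  · rintro h1 m ⟨t₀, ht₀, a, ha, -⟩
    have : t₀ = tops s := funext fun j =>
      Option.map_injective eS.injective ((ht₀ j).symm.trans (h.tops j))
    subst this
    exact h1 a ha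

theorem Step.lift {σ₀ s σ q d} (h : Holds eK eS σ₀ s σ) (hs : F.Step (q, s) d) :
    ∃ σ', (F.lift eK eS).Step (q, σ) (d.1, σ') ∧ Holds eK eS σ₀ d.2 σ' := by
  classical
  obtain ⟨m, hm, h1, h2⟩ := hs
  let u : K' → List S' := fun k => if hk : k ∈ Set.range eK then (m.2 hk.choose).map eS
      else (tops σ k).toList
  have hu : ∀ j, u (eK j) = (m.2 j).map eS := by
    intro j
    have hj : eK j ∈ Set.range eK := ⟨j, rfl⟩
    have := eK.injective hj.choose_spec
    simp only [u, hj, dite_true]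
    rw [this]
  have hu' : ∀ k, k ∉ Set.range eK → u k = (tops σ k).toList := by
    intro k hk
    simp only [u, hk, dite_false]
  refine ⟨fun k => u k ++ (σ k).tail, ⟨(m.1, u), ⟨tops s, h.tops, m, hm, rfl, hu, hu'⟩, h1,
    fun k => rfl⟩, fun j => ?_, fun k hk => ?_⟩
  · simp [hu, h2, h.1]
  · change u k ++ (σ k).tail = σ₀ k
    rw [hu' k hk, ← h.2 k hk]
    exact toList_head?_append_tail _

theorem step_lift {σ₀ s σ q x} (h : Holds eK eS σ₀ s σ)
    (hs : (F.lift eK eS).Step (q, σ) x) :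
    ∃ d, F.Step (q, s) d ∧ x.1 = d.1 ∧ Holds eK eS σ₀ d.2 x.2 := by
  obtain ⟨m, ⟨t₀, ht₀, a, ha, h1, h2, h3⟩, h4, h5⟩ := hs
  have : t₀ = tops s := funext fun j =>
    Option.map_injective eS.injective ((ht₀ j).symm.trans (h.tops j))
  subst this
  refine ⟨(a.1, fun k => a.2 k ++ (s k).tail), ⟨a, ha, rfl, fun k => rfl⟩, h4.trans h1,
    fun j => ?_, fun k hk => ?_⟩
  · simp [h5, h2, h.1]
  · rw [h5, h3 k hk, ← h.2 k hk]
    exact toList_head?_append_tail _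

theorem Run.lift {k c d} (hr : F.Run k c d) {σ₀ σ} (h : Holds eK eS σ₀ c.2 σ) :
    ∃ σ', (F.lift eK eS).Run k (c.1, σ) (d.1, σ') ∧ Holds eK eS σ₀ d.2 σ' := by
  induction hr generalizing σ with
  | refl => exact ⟨σ, .refl _, h⟩
  | step hs _ ih =>
    obtain ⟨σ', h1, h2⟩ := hs.lift h
    obtain ⟨σ'', h3, h4⟩ := ih h2
    exact ⟨σ'', .step h1 h3, h4⟩

/-- The simulation read backwards: the lifted fragment has no runs beyond those of `F`. Time and
space bounds on all runs therefore pass to the lifted fragment. -/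
theorem run_lift {k x y} (hr : (F.lift eK eS).Run k x y) {σ₀ s} (h : Holds eK eS σ₀ s x.2) :
    ∃ d, F.Run k (x.1, s) d ∧ y.1 = d.1 ∧ Holds eK eS σ₀ d.2 y.2 := by
  induction hr generalizing s with
  | refl c => exact ⟨(c.1, s), .refl _, rfl, h⟩
  | step hs _ ih =>
    obtain ⟨d, h1, h2, h3⟩ := step_lift h hs
    obtain ⟨e, h4, h5⟩ := ih h3
    rw [h2] at h4
    exact ⟨e, .step h1 h4, h5⟩

theorem HaltsIn.lift {T s q s'} (hr : F.HaltsIn T s q s') {σ} (h : Holds eK eS σ s σ) :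
    ∃ σ', (F.lift eK eS).HaltsIn T σ q σ' ∧ Holds eK eS σ s' σ' := by
  obtain ⟨t, ht, h1, h2⟩ := hr
  obtain ⟨σ', h3, h4⟩ := h1.lift h
  exact ⟨σ', ⟨t, ht, h3, (halted_lift h4).2 h2⟩, h4⟩

end Lift

/-! ### Loops over a stack -/

section Pass

variable {Q : Type}

open Classical in
/-- Pop the symbols of the stack `a` one after the other until the stack is empty. The symbols are
processed with the finite control `Q`; `δ` gives the new state and the words that replace the
tops of the other stacks. -/
noncomputable def pass [hQ : Finite Q] (a : K) (q₀ : Q)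
    (δ : Q → S → (K → Option S) → Q × (K → List S)) : Frag K S where
  State := Q
  finState := hQ
  start := q₀
  next q t := {m | ∃ x, t a = some x ∧ m = ((δ q x t).1, fun k => if k = a then [] else
    (δ q x t).2 k)}
  next_finite q t := by
    refine Set.Subsingleton.finite ?_
    rintro m ⟨x, hx, rfl⟩ m' ⟨x', hx', rfl⟩
    obtain rfl := Option.some.inj (hx.symm.trans hx')
    rfl

variable [Finite Q] {a : K} {q₀ : Q} {δ : Q → S → (K → Option S) → Q × (K → List S)}

theorem det_pass : (pass a q₀ δ).Det := by
  rintro q t m ⟨x, hx, rfl⟩ m' ⟨x', hx', rfl⟩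
  obtain rfl := Option.some.inj (hx.symm.trans hx')
  rfl

open Classical in
-- Invariant rule for loops. `I` sees the unread rest of the stack `a`, the control state and the
-- stacks. Every step pops exactly one symbol of `a` and pushes nothing on it, so the loop ends
-- after `l.length` steps.
theorem run_pass (I : List S → Q → (K → List S) → Prop)
    (hI : ∀ x l q s, s a = x :: l → I (x :: l) q s →
      I l (δ q x (tops s)).1
        (fun k => if k = a then l else (δ q x (tops s)).2 k ++ (s k).tail)) :
    ∀ l q s, s a = l → I l q s → ∃ q' s', (pass a q₀ δ).Run l.length (q, s) (q', s') ∧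
      (pass a q₀ δ).Halted (q', s') ∧ s' a = [] ∧ I [] q' s' := by
  intro l
  induction l with
  | nil =>
    intro q s hs h
    refine ⟨q, s, .refl _, ?_, hs, h⟩
    refine Set.eq_empty_iff_forall_notMem.2 ?_
    rintro m ⟨x, hx, -⟩
    simp [tops, hs] at hx
  | cons x l ih =>
    intro q s hs h
    obtain ⟨q', s', h1, h2⟩ := ih _ _ (by simp) (hI x l q s hs h)
    refine ⟨q', s', ?_, h2⟩
    refine Run.step (c' := ((δ q x (tops s)).1, fun k => if k = a then l else
      (δ q x (tops s)).2 k ++ (s k).tail)) ⟨((δ q x (tops s)).1, fun k => if k = a then [] else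
      (δ q x (tops s)).2 k), ⟨x, by simp [tops, hs], rfl⟩, rfl, fun k => ?_⟩ h1
    by_cases hk : k = a
    · simp [hk, hs]
    · simp [hk]

open Classical in
theorem haltsIn_pass (I : List S → Q → (K → List S) → Prop)
    (hI : ∀ x l q s, s a = x :: l → I (x :: l) q s →
      I l (δ q x (tops s)).1
        (fun k => if k = a then l else (δ q x (tops s)).2 k ++ (s k).tail))
    {s} (h : I (s a) q₀ s) : ∃ q' s', (pass a q₀ δ).HaltsIn (s a).length s q' s' ∧
      s' a = [] ∧ I [] q' s' := by
  obtain ⟨q', s', h1, h2, h3⟩ := run_pass (q₀ := q₀) I hI _ q₀ s rfl h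
  exact ⟨q', s', ⟨_, le_rfl, h1, h2⟩, h3⟩

/-- Pop the symbols of the stack `a` one after the other, and push for each symbol `x` the word
`u x k` on each other stack `k`. -/
noncomputable def move (a : K) (u : S → K → List S) : Frag K S :=
  pass (Q := Unit) a () fun q x t => (q, fun k => u x k ++ (t k).toList)

theorem det_move {u : S → K → List S} : (move a u).Det := det_pass

theorem haltsIn_move (u : S → K → List S) (s : K → List S) :
    ∃ q s', (move a u).HaltsIn (s a).length s q s' ∧ s' a = [] ∧
      ∀ k, k ≠ a → s' k = (s a).reverse.flatMap (fun x => u x k) ++ s k := by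
  obtain ⟨q, s', h1, h2, h3⟩ := haltsIn_pass (a := a) (q₀ := ())
    (δ := fun q x t => (q, fun k => u x k ++ (t k).toList)) (s := s)
    -- Invariant: the stack as it would be after the unread rest `l` is processed too. The reversal
    -- appears because the symbol popped last ends up on top.
    (fun l _ s' => ∀ k, k ≠ a → l.reverse.flatMap (fun x => u x k) ++ s' k =
      (s a).reverse.flatMap (fun x => u x k) ++ s k)
    (by
      intro x l q s' hs' h k hk
      rw [← h k hk]
      simp only [hk, if_false, List.reverse_cons, List.flatMap_append, List.append_assoc,
        List.append_cancel_left_eq, tops]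
      rw [toList_head?_append_tail]
      simp)
    (fun k _ => rfl)
  exact ⟨q, s', h1, h2, fun k hk => by simpa using h3 k hk⟩

end Pass

end Frag

/-! ## Fragments and machines -/

open Classical in
/-- The stacks that hold the word `l` on the stack `i` and nothing else. -/
noncomputable def single {K S : Type} (i : K) (l : List S) : K → List S :=
  fun j => if j = i then l else []

/-- The fragment underlying a machine. -/
def Machine.toFrag {α : Type} (M : Machine α) : Frag M.Stack M.Sym where
  State := M.State
  finState := M.finState
  start := M.start
  next := M.next
  next_finite := M.next_finite

/-- A fragment as a machine. -/
def Frag.toMachine {α K S : Type} [hK : Finite K] [hS : Finite S] (F : Frag K S) (inp : α ↪ S)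
    (i o : K) (acc : Set F.State) : Machine α where
  State := F.State
  Stack := K
  Sym := S
  finState := F.finState
  finStack := hK
  finSym := hS
  input := inp
  inStack := i
  outStack := o
  start := F.start
  accept := acc
  next := F.next
  next_finite := F.next_finite

namespace Machine

variable {α : Type} {M : Machine α}

theorem run_toFrag {k c d} (h : M.Run k c d) :
    M.toFrag.Run k (c.state, c.stack) (d.state, d.stack) := by
  induction h with
  | refl => exact .refl _
  | @step k c c' c'' h _ ih =>
    exact .step (show M.toFrag.Step (c.state, c.stack) (c'.state, c'.stack) from h) ih

theorem run_of_toFrag {k x y} (h : M.toFrag.Run k x y) : M.Run k ⟨x.1, x.2⟩ ⟨y.1, y.2⟩ := by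
  induction h with
  | refl => exact .refl _
  | @step k c c' c'' h _ ih =>
    exact .step (show M.Step ⟨c.1, c.2⟩ ⟨c'.1, c'.2⟩ from h) ih

end Machine

namespace Polynomial

/-- The coefficients are natural numbers. Monotonicity is what lets a bound on the length of an
intermediate word be inserted into the bound of the next machine. -/
theorem monotone_eval_nat (p : Polynomial ℕ) : Monotone fun n => p.eval n := by
  intro a b h
  induction p using Polynomial.induction_on' with
  | add p q hp hq => simpa using add_le_add hp hq
  | monomial n c => simpa using Nat.mul_le_mul_left c (Nat.pow_le_pow_left h n)

end Polynomial

/-! ### The complexity classes in terms of fragments -/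

section Classes

variable {α β γ : Type}

/-- By determinism the bound on the one halting computation already bounds all computations, so
halting, time and output can be stated together. -/
theorem polyTimeComputable_iff {f : List α → List β} :
    PolyTimeComputable f ↔ ∃ (K S : Type) (_ : Finite K) (_ : Finite S) (F : Frag K S)
      (inp : α ↪ S) (i o : K) (out : β ↪ S) (p : Polynomial ℕ), F.Det ∧
      ∀ w, ∃ q s, F.HaltsIn (p.eval w.length) (single i (w.map inp)) q s ∧
        s o = (f w).map out := by
  constructor
  · rintro ⟨M, out, p, hM, hp, h⟩
    refine ⟨M.Stack, M.Sym, M.finStack, M.finSym, M.toFrag, M.input, M.inStack, M.outStack, out,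
      p, hM, fun w => ?_⟩
    obtain ⟨k, c, h1, h2, h3⟩ := h w
    exact ⟨c.state, c.stack, ⟨k, hp w k c h1, Machine.run_toFrag h1, h2⟩, h3⟩
  · rintro ⟨K, S, _, _, F, inp, i, o, out, p, hF, h⟩
    refine ⟨F.toMachine inp i o ∅, out, p, hF, fun w k c hr => ?_, fun w => ?_⟩
    · obtain ⟨q, s, h1, -⟩ := h w
      exact (hF.haltsIn h1 (Machine.run_toFrag hr)).1
    · obtain ⟨q, s, ⟨k, -, h1, h2⟩, h3⟩ := h w
      exact ⟨k, ⟨q, s⟩, Machine.run_of_toFrag (M := F.toMachine inp i o ∅) h1, h2, h3⟩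

theorem single_length_le {K S : Type} (i j : K) (l : List S) :
    (single i l j).length ≤ l.length := by
  unfold single
  split <;> simp

/-- Within `p n` steps a stack that starts with at most `n` symbols gains at most `b * p n`. -/
theorem PolyTimeComputable.length_le {f : List α → List β} (hf : PolyTimeComputable f) :
    ∃ p : Polynomial ℕ, ∀ w, (f w).length ≤ p.eval w.length := by
  obtain ⟨K, S, _, _, F, inp, i, o, out, p, hF, h⟩ := polyTimeComputable_iff.1 hf
  obtain ⟨b, hb⟩ := F.exists_growth
  refine ⟨Polynomial.X + Polynomial.C b * p, fun w => ?_⟩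
  obtain ⟨q, s, ⟨t, ht, h1, -⟩, h2⟩ := h w
  have h3 := hb h1 o
  have h4 := single_length_le i o (w.map inp)
  have h5 := Nat.mul_le_mul_left b ht
  simp only [h2, List.length_map] at h3 h4
  simp
  omega

theorem ComplexityClass.mem_NP_iff {A : Language α} :
    A ∈ ComplexityClass.NP α ↔ ∃ (K S : Type) (_ : Finite K) (_ : Finite S) (F : Frag K S)
      (inp : α ↪ S) (i : K) (acc : Set F.State) (p : Polynomial ℕ),
      (∀ (w : List α) k c, F.Run k (F.start, single i (w.map inp)) c → k ≤ p.eval w.length) ∧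
      ∀ w, w ∈ A ↔ ∃ k c, F.Run k (F.start, single i (w.map inp)) c ∧ F.Halted c ∧
        c.1 ∈ acc := by
  constructor
  · rintro ⟨M, p, hp, h⟩
    refine ⟨M.Stack, M.Sym, M.finStack, M.finSym, M.toFrag, M.input, M.inStack, M.accept, p,
      fun w k c hr => hp w k _ (Machine.run_of_toFrag hr), fun w => (h w).trans ?_⟩
    constructor
    · rintro ⟨k, c, h1, h2⟩
      exact ⟨k, _, Machine.run_toFrag h1, h2⟩
    · rintro ⟨k, c, h1, h2⟩
      exact ⟨k, _, Machine.run_of_toFrag h1, h2⟩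
  · rintro ⟨K, S, _, _, F, inp, i, acc, p, hp, h⟩
    refine ⟨F.toMachine inp i i acc, p, fun w k c hr => hp w k _ (Machine.run_toFrag hr),
      fun w => (h w).trans ?_⟩
    constructor
    · rintro ⟨k, c, h1, h2⟩
      exact ⟨k, _, Machine.run_of_toFrag (M := F.toMachine inp i i acc) h1, h2⟩
    · rintro ⟨k, c, h1, h2⟩
      exact ⟨k, _, Machine.run_toFrag h1, h2⟩

/-- A deterministic machine has a unique halting configuration, so acceptance can be read off any
halting run. In this form rejection is as explicit as acceptance. -/
theorem ComplexityClass.mem_PSPACE_iff {A : Language α} :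
    A ∈ ComplexityClass.PSPACE α ↔ ∃ (K S : Type) (_ : Finite K) (_ : Finite S) (F : Frag K S)
      (inp : α ↪ S) (i : K) (acc : Set F.State) (p : Polynomial ℕ), F.Det ∧
      (∀ (w : List α) k c, F.Run k (F.start, single i (w.map inp)) c →
        ∀ j, (c.2 j).length ≤ p.eval w.length) ∧
      ∀ w, ∃ k c, F.Run k (F.start, single i (w.map inp)) c ∧ F.Halted c ∧
        (w ∈ A ↔ c.1 ∈ acc) := by
  constructor
  · rintro ⟨M, p, hM, hp, hh, h⟩
    refine ⟨M.Stack, M.Sym, M.finStack, M.finSym, M.toFrag, M.input, M.inStack, M.accept, p, hM,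
      fun w k c hr => hp w k _ (Machine.run_of_toFrag hr), fun w => ?_⟩
    obtain ⟨k, c, h1, h2⟩ := hh w
    refine ⟨k, _, Machine.run_toFrag h1, h2, (h w).trans ⟨?_, fun hc => ⟨k, c, h1, h2, hc⟩⟩⟩
    rintro ⟨k', c', h1', h2', h3'⟩
    have := (Frag.Det.run_le (F := M.toFrag) hM (Machine.run_toFrag h1) h2
      (Machine.run_toFrag h1')).2 h2'
    have h4 := (Prod.ext_iff.1 this.2).1
    dsimp only at h4
    rwa [h4] at h3'
  · rintro ⟨K, S, _, _, F, inp, i, acc, p, hF, hp, h⟩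
    refine ⟨F.toMachine inp i i acc, p, hF, fun w k c hr => hp w k _ (Machine.run_toFrag hr),
      fun w => ?_, fun w => ?_⟩
    · obtain ⟨k, c, h1, h2, -⟩ := h w
      exact ⟨k, _, Machine.run_of_toFrag (M := F.toMachine inp i i acc) h1, h2⟩
    · obtain ⟨k, c, h1, h2, h3⟩ := h w
      refine h3.trans ⟨fun hc => ⟨k, _, Machine.run_of_toFrag (M := F.toMachine inp i i acc) h1,
        h2, hc⟩, ?_⟩
      rintro ⟨k', c', h1', h2', h3'⟩
      have := (hF.run_le h1 h2 (Machine.run_toFrag h1')).2 h2'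
      have h4 := (Prod.ext_iff.1 this.2).1
      dsimp only at h4
      rwa [← h4]

end Classes

/-! ### Moving words between stacks -/

namespace Frag

variable {K S β : Type}

open Classical in
/-- Some map that takes `e b` to `e' b`. -/
noncomputable def translate (e e' : β ↪ S) (x : S) : S :=
  if h : ∃ b, e b = x then e' h.choose else x

theorem translate_apply (e e' : β ↪ S) (b : β) : translate e e' (e b) = e' b := by
  have h : ∃ b', e b' = e b := ⟨b, rfl⟩
  have h' := e.injective h.choose_spec
  rw [translate, dif_pos h, h']

theorem flatMap_nil_fun {α : Type} (l : List α) : l.flatMap (fun _ => ([] : List β)) = [] := by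
  simp

theorem flatMap_pure_fun {α : Type} (l : List α) (f : α → β) :
    l.flatMap (fun x => [f x]) = l.map f := by
  induction l with
  | nil => rfl
  | cons x l ih => simpa using ih

open Classical in
/-- Move the word on the stack `a` to the stack `b`, using the auxiliary stack `c`, and apply `τ`
to its symbols. -/
noncomputable def transfer (a c b : K) (τ : S → S) : Frag K S :=
  (move a fun x k => if k = c then [x] else []).seq Set.univ
    (move c fun x k => if k = b then [τ x] else [])

theorem det_transfer {a c b : K} {τ : S → S} : (transfer a c b τ).Det := det_move.seq det_move

open Classical in
-- Each of the two moves reverses the word, so its order is restored. The extra step is the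
-- handover. The case `b = a` is allowed: `a` is empty by the time the word returns.
theorem haltsIn_transfer {a c b : K} (hac : a ≠ c) (hbc : b ≠ c) (τ : S → S)
    {s : K → List S} (hc : s c = []) : ∃ q s', (transfer a c b τ).HaltsIn
      (2 * (s a).length + 1) s q s' ∧ s' b = (s a).map τ ++ (if b = a then [] else s b) ∧
      (∀ k, k ≠ a → k ≠ b → s' k = s k) := by
  obtain ⟨q₁, s₁, h1, h2, h3⟩ := haltsIn_move (a := a) (fun x k => if k = c then [x] else []) s
  obtain ⟨q₂, s₂, h4, h5, h6⟩ := haltsIn_move (a := c) (fun x k => if k = b then [τ x] else []) s₁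
  have h7 : s₁ c = (s a).reverse := by
    rw [h3 c hac.symm, hc]
    simp
  refine ⟨_, s₂, (h1.seq (Set.mem_univ _) h4).mono ?_, ?_, fun k hka hkb => ?_⟩
  · rw [h7, List.length_reverse]
    omega
  · rw [h6 b hbc, h7]
    congr 1
    · simp only [if_true, List.reverse_reverse, flatMap_pure_fun]
    · split
      · next h => rw [h, h2]
      · next h => rw [h3 b h]; simp [hbc, flatMap_nil_fun]
  · by_cases hkc : k = c
    · rw [hkc, h5, hc]
    · rw [h6 k hkc, h3 k hka]
      simp [hkb, hkc, flatMap_nil_fun]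

/-- Copies of a word as inputs of two fragments. -/
theorem exists_copy {α K₁ K₂ S₁ S₂ : Type} (i₁ : K₁) (i₂ : K₂) (inp₁ : α ↪ S₁) (inp₂ : α ↪ S₂) :
    ∃ (H : Frag (K₁ ⊕ K₂ ⊕ Bool) (S₁ ⊕ S₂)) (i : K₁ ⊕ K₂ ⊕ Bool) (inp : α ↪ S₁ ⊕ S₂), H.Det ∧
      ∀ w : List α, ∃ q s, H.HaltsIn (2 * w.length + 1) (single i (w.map inp)) q s ∧
        (∀ j, s (Sum.inl j) = (single i₁ (w.map inp₁) j).map Sum.inl) ∧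
        (∀ j, s (Sum.inr (Sum.inl j)) = (single i₂ (w.map inp₂) j).map Sum.inr) ∧
        ∀ b, s (Sum.inr (Sum.inr b)) = [] := by
  classical
  let e₁ : α ↪ S₁ ⊕ S₂ := inp₁.trans Function.Embedding.inl
  let e₂ : α ↪ S₁ ⊕ S₂ := inp₂.trans Function.Embedding.inr
  let a : K₁ ⊕ K₂ ⊕ Bool := Sum.inr (Sum.inr false)
  let c : K₁ ⊕ K₂ ⊕ Bool := Sum.inr (Sum.inr true)
  let u : S₁ ⊕ S₂ → K₁ ⊕ K₂ ⊕ Bool → List (S₁ ⊕ S₂) := fun x k =>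
    if k = c then [x] else []
  -- The second pass writes both copies at once, one in each alphabet. The two stacks indexed by
  -- `Bool` hold the input and its reversal.
  let v : S₁ ⊕ S₂ → K₁ ⊕ K₂ ⊕ Bool → List (S₁ ⊕ S₂) := fun x k =>
    if k = Sum.inl i₁ then [x] else if k = Sum.inr (Sum.inl i₂) then [translate e₁ e₂ x] else []
  refine ⟨(move a u).seq Set.univ (move c v), a, e₁, det_move.seq det_move, fun w => ?_⟩
  obtain ⟨q₁, s₁, h1, h2, h3⟩ := haltsIn_move (a := a) u (single a (w.map e₁))
  obtain ⟨q₂, s₂, h4, h5, h6⟩ := haltsIn_move (a := c) v s₁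
  have h7 : s₁ c = (w.map e₁).reverse := by
    rw [h3 c (by simp [a, c])]
    simp [u, single, a, c]
  have h8 : ∀ k, k ≠ c → s₁ k = [] := by
    intro k hk
    by_cases hka : k = a
    · rw [hka, h2]
    · rw [h3 k hka]
      simp [u, single, hk, hka]
  refine ⟨_, s₂, (h1.seq (Set.mem_univ _) h4).mono ?_, fun j => ?_, fun j => ?_, fun b => ?_⟩
  · simp [h7, single]
    omega
  · rw [h6 _ (by simp [c]), h7, h8 _ (by simp [c])]
    by_cases hj : j = i₁
    · simp only [v, single, hj, if_true, List.reverse_reverse, flatMap_pure_fun]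
      simp [e₁]
    · simp [v, single, hj, flatMap_nil_fun]
  · rw [h6 _ (by simp [c]), h7, h8 _ (by simp [c])]
    by_cases hj : j = i₂
    · simp only [v, single, hj, if_true, List.reverse_reverse, reduceCtorEq, if_false,
        flatMap_pure_fun]
      simp [translate_apply, e₂]
    · simp [v, single, hj, flatMap_nil_fun]
  · by_cases hb : b = true
    · rw [hb, h5]
    · have hb' : (Sum.inr (Sum.inr b) : K₁ ⊕ K₂ ⊕ Bool) ≠ c := by simpa [c] using hb
      rw [h6 _ hb', h8 _ hb']
      simp [v]

end Frag

/-! ## Closure properties of the complexity classes -/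

section Closure

variable {α β γ : Type}

theorem single_map {K S K' S' : Type} (eK : K ↪ K') (eS : S ↪ S') (i : K) (l : List S) (j : K) :
    single (eK i) (l.map eS) (eK j) = (single i l j).map eS := by
  by_cases h : j = i <;> simp [single, h]

theorem single_of_ne {K S : Type} {i k : K} (h : k ≠ i) (l : List S) : single i l k = [] := by
  simp [single, h]

theorem holds_single {K S K' S' : Type} (eK : K ↪ K') (eS : S ↪ S') (i : K) (l : List S) :
    Frag.Holds eK eS (single (eK i) (l.map eS)) (single i l) (single (eK i) (l.map eS)) :=
  ⟨single_map eK eS i l, fun _ _ => rfl⟩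

/-- A function in polynomial time can prepare the input of another fragment. -/
theorem PolyTimeComputable.exists_feed {f : List α → List β} (hf : PolyTimeComputable f)
    {K₂ S₂ : Type} [Finite K₂] [Finite S₂] (i₂ : K₂) (inp₂ : β ↪ S₂) :
    ∃ (K S : Type) (_ : Finite K) (_ : Finite S) (eK : K₂ ↪ K) (eS : S₂ ↪ S) (H : Frag K S)
      (inp : α ↪ S) (i : K) (p : Polynomial ℕ), H.Det ∧
      ∀ w, ∃ q s, H.HaltsIn (p.eval w.length) (single i (w.map inp)) q s ∧
        Frag.Holds eK eS s (single i₂ ((f w).map inp₂)) s := by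
  obtain ⟨r, hr⟩ := hf.length_le
  obtain ⟨K₁, S₁, _, _, F, inp, i, o, out, p, hF, h⟩ := polyTimeComputable_iff.1 hf
  let eK₁ : K₁ ↪ K₁ ⊕ K₂ ⊕ Unit := Function.Embedding.inl
  let eK₂ : K₂ ↪ K₁ ⊕ K₂ ⊕ Unit := Function.Embedding.inl.trans Function.Embedding.inr
  let eS₁ : S₁ ↪ S₁ ⊕ S₂ := Function.Embedding.inl
  let eS₂ : S₂ ↪ S₁ ⊕ S₂ := Function.Embedding.inr
  let c : K₁ ⊕ K₂ ⊕ Unit := Sum.inr (Sum.inr ())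
  let τ := Frag.translate (out.trans eS₁) (inp₂.trans eS₂)
  -- `F` works on its own stacks; its output is then moved to the input stack of the second fragment
  -- and rewritten in that alphabet. The move takes twice the length of `f w`, which `r` bounds.
  refine ⟨_, _, inferInstance, inferInstance, eK₂, eS₂, (F.lift eK₁ eS₁).seq Set.univ
    (Frag.transfer (eK₁ o) c (eK₂ i₂) τ), inp.trans eS₁, eK₁ i, p + 1 + (2 * r + 1),
    hF.lift.seq Frag.det_transfer, fun w => ?_⟩
  obtain ⟨q, s, h1, h2⟩ := h w
  have h3 := holds_single eK₁ eS₁ i (w.map inp)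
  obtain ⟨s₁, h4, h5, h6⟩ := h1.lift h3
  have h7 : ∀ k, s₁ (Sum.inr k) = [] := by
    intro k
    rw [h6 _ (by simp [eK₁]), single_of_ne (by simp [eK₁])]
  obtain ⟨q₂, s₂, h8, h9, h10⟩ := Frag.haltsIn_transfer (a := eK₁ o) (c := c) (b := eK₂ i₂)
    (by simp [eK₁, c]) (by simp [eK₂, c]) τ (h7 _)
  refine ⟨Sum.inr q₂, s₂, ?_, fun j => ?_, fun _ _ => rfl⟩
  · rw [List.map_map] at h4
    refine (h4.seq (Set.mem_univ _) h8).mono ?_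
    have h11 := hr w
    simp only [h5, h2, List.length_map, Polynomial.eval_add, Polynomial.eval_mul,
      Polynomial.eval_one, Polynomial.eval_ofNat]
    omega
  · by_cases hj : j = i₂
    · rw [hj, h9, h5, h2, if_neg (by simp [eK₁, eK₂]), show s₁ (eK₂ i₂) = [] from h7 _]
      simp only [single, if_true, List.map_map, List.append_nil, List.map_inj_left]
      exact fun b _ => Frag.translate_apply (out.trans eS₁) (inp₂.trans eS₂) b
    · rw [h10 _ (by simp [eK₁, eK₂]) (by simpa [eK₂] using hj), single_of_ne hj]
      exact h7 _

theorem PolyTimeComputable.comp {g : List β → List γ} {f : List α → List β}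
    (hg : PolyTimeComputable g) (hf : PolyTimeComputable f) :
    PolyTimeComputable fun w => g (f w) := by
  obtain ⟨r, hr⟩ := hf.length_le
  obtain ⟨K₂, S₂, _, _, G, inp₂, i₂, o, out, p₂, hG, hg⟩ := polyTimeComputable_iff.1 hg
  obtain ⟨K, S, _, _, eK, eS, H, inp, i, p, hH, h⟩ := hf.exists_feed i₂ inp₂
  refine polyTimeComputable_iff.2 ⟨K, S, inferInstance, inferInstance,
    H.seq Set.univ (G.lift eK eS), inp, i, eK o, out.trans eS, p + 1 + p₂.comp r,
    hH.seq hG.lift, fun w => ?_⟩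
  obtain ⟨q, s, h1, h2⟩ := h w
  obtain ⟨q₂, s₂, h3, h4⟩ := hg (f w)
  obtain ⟨s₃, h5, h6⟩ := h3.lift h2
  refine ⟨_, s₃, (h1.seq (Set.mem_univ _) h5).mono ?_, ?_⟩
  · simp only [Polynomial.eval_add, Polynomial.eval_one, Polynomial.eval_comp]
    exact Nat.add_le_add_left (p₂.monotone_eval_nat (hr w)) _
  · rw [h6.1, h4, List.map_map]
    rfl

/-- Both fragments work on disjoint stacks, each with its own copy of the input. At the end the
output of the first is moved on top of the output of the second. -/
theorem PolyTimeComputable.append {f g : List α → List β}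
    (hf : PolyTimeComputable f) (hg : PolyTimeComputable g) :
    PolyTimeComputable fun w => f w ++ g w := by
  obtain ⟨r, hr⟩ := hf.length_le
  obtain ⟨K₁, S₁, _, _, F, inp₁, i₁, o₁, out₁, p₁, hF, hf⟩ := polyTimeComputable_iff.1 hf
  obtain ⟨K₂, S₂, _, _, G, inp₂, i₂, o₂, out₂, p₂, hG, hg⟩ := polyTimeComputable_iff.1 hg
  let eK₁ : K₁ ↪ K₁ ⊕ K₂ ⊕ Bool := Function.Embedding.inl
  let eK₂ : K₂ ↪ K₁ ⊕ K₂ ⊕ Bool := Function.Embedding.inl.trans Function.Embedding.inr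
  let eS₁ : S₁ ↪ S₁ ⊕ S₂ := Function.Embedding.inl
  let eS₂ : S₂ ↪ S₁ ⊕ S₂ := Function.Embedding.inr
  let c : K₁ ⊕ K₂ ⊕ Bool := Sum.inr (Sum.inr true)
  let τ := Frag.translate (out₁.trans eS₁) (out₂.trans eS₂)
  obtain ⟨H, i, inp, hH, h⟩ := Frag.exists_copy i₁ i₂ inp₁ inp₂
  refine polyTimeComputable_iff.2 ⟨_, _, inferInstance, inferInstance,
    H.seq Set.univ ((F.lift eK₁ eS₁).seq Set.univ ((G.lift eK₂ eS₂).seq Set.univ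
    (Frag.transfer (eK₁ o₁) c (eK₂ o₂) τ))), inp, i, eK₂ o₂, out₂.trans eS₂,
    2 * Polynomial.X + 1 + 1 + (p₁ + 1 + (p₂ + 1 + (2 * r + 1))),
    hH.seq (hF.lift.seq (hG.lift.seq Frag.det_transfer)), fun w => ?_⟩
  obtain ⟨q, s, h1, h2, h3, h4⟩ := h w
  obtain ⟨q₁, t₁, h5, h6⟩ := hf w
  obtain ⟨q₂, t₂, h7, h8⟩ := hg w
  obtain ⟨s₁, h9, h10, h11⟩ := h5.lift (eK := eK₁) (eS := eS₁) (σ := s) ⟨h2, fun _ _ => rfl⟩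
  have h12 : ∀ k, s₁ (Sum.inr k) = s (Sum.inr k) := fun k => h11 _ (by simp [eK₁])
  obtain ⟨s₂, h13, h14, h15⟩ := h7.lift (eK := eK₂) (eS := eS₂) (σ := s₁)
    ⟨fun j => (h12 _).trans (h3 j), fun _ _ => rfl⟩
  have h16 : s₂ c = [] := by
    rw [h15 c (by simp [eK₂, c]), h12, h4]
  have h17 : s₂ (eK₁ o₁) = (f w).map (out₁.trans eS₁) := by
    rw [h15 _ (by simp [eK₁, eK₂]), h10, h6, List.map_map]
    rfl
  obtain ⟨q₃, s₃, h18, h19, -⟩ := Frag.haltsIn_transfer (a := eK₁ o₁) (c := c) (b := eK₂ o₂)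
    (by simp [eK₁, c]) (by simp [eK₂, c]) τ h16
  refine ⟨_, s₃, (h1.seq (Set.mem_univ _) (h9.seq (Set.mem_univ _) (h13.seq (Set.mem_univ _)
    h18))).mono ?_, ?_⟩
  · have h20 := hr w
    simp only [h17, List.length_map, Polynomial.eval_add, Polynomial.eval_mul,
      Polynomial.eval_one, Polynomial.eval_ofNat, Polynomial.eval_X]
    omega
  · rw [h19, h17, if_neg (by simp [eK₁, eK₂]), h14, h8, List.map_append, List.map_map,
      List.map_map]
    congr 1
    simp only [List.map_inj_left]
    exact fun b _ => Frag.translate_apply (out₁.trans eS₁) (out₂.trans eS₂) b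

/-- The preparation is deterministic, so every computation that reaches the nondeterministic part
enters it with exactly the input `f w`. Hence no computation is longer than the sum of the two
bounds, and acceptance is that of `G` on `f w`. -/
theorem ComplexityClass.preimage_mem_NP {f : List α → List β} (hf : PolyTimeComputable f)
    {A : Language β} (hA : A ∈ NP β) : ({w | f w ∈ A} : Language α) ∈ NP α := by
  obtain ⟨r, hr⟩ := hf.length_le
  obtain ⟨K₂, S₂, _, _, G, inp₂, i₂, acc, p₂, hp₂, hG⟩ := mem_NP_iff.1 hA
  obtain ⟨K, S, _, _, eK, eS, H, inp, i, p, hH, h⟩ := hf.exists_feed i₂ inp₂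
  refine mem_NP_iff.2 ⟨K, S, inferInstance, inferInstance, H.seq Set.univ (G.lift eK eS), inp, i,
    Sum.inr '' acc, p + 1 + p₂.comp r, fun w k c hc => ?_, fun w => ?_⟩
  · obtain ⟨q, s, h1, h2⟩ := h w
    simp only [Polynomial.eval_add, Polynomial.eval_one, Polynomial.eval_comp]
    rcases Frag.run_seq hc (c := (H.start, _)) rfl with
      ⟨d, hd, rfl⟩ | ⟨k₁, d, j, e, hd, hh, -, he, rfl, rfl⟩
    · have := (hH.haltsIn h1 hd).1
      omega
    · have h3 := hH.haltsIn h1 hd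
      obtain rfl := h3.2 hh
      obtain ⟨d', h4, -⟩ := Frag.run_lift he h2
      have h5 := (hp₂ _ _ _ h4).trans (p₂.monotone_eval_nat (hr w))
      dsimp only at h5
      omega
  · obtain ⟨q, s, h1, h2⟩ := h w
    refine (hG (f w)).trans ⟨?_, ?_⟩
    · rintro ⟨k, c, h3, h4, h5⟩
      obtain ⟨s', h6, h7⟩ := h3.lift h2
      obtain ⟨t, -, h8, h9⟩ := h1
      exact ⟨_, _, h8.seq h9 (Set.mem_univ _) h6, Frag.halted_seq_inr.2
        ((Frag.halted_lift h7).2 h4), ⟨_, h5, rfl⟩⟩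
    · rintro ⟨k, c, hc, h4, h5⟩
      rcases Frag.run_seq hc (c := (H.start, _)) rfl with
        ⟨d, hd, rfl⟩ | ⟨k₁, d, j, e, hd, hh, -, he, rfl, rfl⟩
      · obtain ⟨x, -, hx⟩ := h5
        exact absurd hx Sum.inr_ne_inl
      · obtain rfl := (hH.haltsIn h1 hd).2 hh
        obtain ⟨d', h6, h7, h8⟩ := Frag.run_lift he h2
        refine ⟨_, _, h6, (Frag.halted_lift h8).1 ?_, ?_⟩
        · have := Frag.halted_seq_inr.1 h4
          rwa [← h7]
        · obtain ⟨x, hx, hx'⟩ := h5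
          obtain rfl := Sum.inr_injective hx'
          rwa [← h7]

/-- While `f w` is prepared, the stacks are bounded by the time this takes. Afterwards only the
stacks of `G` change, and the rest stay as the preparation left them. -/
theorem ComplexityClass.preimage_mem_PSPACE {f : List α → List β} (hf : PolyTimeComputable f)
    {A : Language β} (hA : A ∈ PSPACE β) : ({w | f w ∈ A} : Language α) ∈ PSPACE α := by
  obtain ⟨r, hr⟩ := hf.length_le
  obtain ⟨K₂, S₂, _, _, G, inp₂, i₂, acc, p₂, hG, hp₂, hA⟩ := mem_PSPACE_iff.1 hA
  obtain ⟨K, S, _, _, eK, eS, H, inp, i, p, hH, h⟩ := hf.exists_feed i₂ inp₂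
  obtain ⟨b, hb⟩ := H.exists_growth
  refine mem_PSPACE_iff.2 ⟨K, S, inferInstance, inferInstance, H.seq Set.univ (G.lift eK eS),
    inp, i, Sum.inr '' acc, Polynomial.X + Polynomial.C b * p + p₂.comp r, hH.seq hG.lift,
    fun w k c hc => ?_, fun w => ?_⟩
  · obtain ⟨q, s, h1, h2⟩ := h w
    have h3 : ∀ {k d}, H.Run k (H.start, single i (w.map inp)) d → ∀ j, (d.2 j).length ≤
        w.length + b * p.eval w.length := by
      intro k d hd j
      refine (hb hd j).trans (add_le_add ?_ (Nat.mul_le_mul_left b (hH.haltsIn h1 hd).1))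
      simpa using single_length_le i j (w.map inp)
    simp only [Polynomial.eval_add, Polynomial.eval_X, Polynomial.eval_mul, Polynomial.eval_C,
      Polynomial.eval_comp]
    rcases Frag.run_seq hc (c := (H.start, _)) rfl with
      ⟨d, hd, rfl⟩ | ⟨k₁, d, j, e, hd, hh, -, he, rfl, rfl⟩
    · exact fun j => (h3 hd j).trans (Nat.le_add_right _ _)
    · obtain rfl := (hH.haltsIn h1 hd).2 hh
      obtain ⟨d', h4, -, h5, h6⟩ := Frag.run_lift he h2
      intro k
      by_cases hk : k ∈ Set.range eK
      · obtain ⟨j, rfl⟩ := hk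
        dsimp only
        rw [h5, List.length_map]
        exact ((hp₂ _ _ _ h4 j).trans (p₂.monotone_eval_nat (hr w))).trans (Nat.le_add_left _ _)
      · dsimp only
        rw [h6 k hk]
        exact (h3 hd k).trans (Nat.le_add_right _ _)
  · obtain ⟨q, s, h1, h2⟩ := h w
    obtain ⟨k, c, h3, h4, h5⟩ := hA (f w)
    obtain ⟨s', h6, h7⟩ := h3.lift h2
    obtain ⟨t, -, h8, h9⟩ := h1
    refine ⟨_, _, h8.seq h9 (Set.mem_univ _) h6, Frag.halted_seq_inr.2
      ((Frag.halted_lift h7).2 h4), h5.trans ?_⟩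
    exact Sum.inr_injective.mem_set_image.symm

theorem ComplexityClass.compl_mem_PSPACE {A : Language α} (hA : A ∈ PSPACE α) :
    Aᶜ ∈ PSPACE α := by
  obtain ⟨K, S, _, _, F, inp, i, acc, p, hF, hp, h⟩ := mem_PSPACE_iff.1 hA
  refine mem_PSPACE_iff.2 ⟨K, S, inferInstance, inferInstance, F, inp, i, accᶜ, p, hF, hp,
    fun w => ?_⟩
  obtain ⟨k, c, h1, h2, h3⟩ := h w
  exact ⟨k, c, h1, h2, not_congr h3⟩

/-- Run `F` on one copy of the input and start `G` on the other copy only if `F` accepts. A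
rejection by `F` halts the composition in a state of `F`, which is not accepting. -/
theorem ComplexityClass.inf_mem_PSPACE {A B : Language α} (hA : A ∈ PSPACE α)
    (hB : B ∈ PSPACE α) : A ⊓ B ∈ PSPACE α := by
  obtain ⟨K₁, S₁, _, _, F, inp₁, i₁, acc₁, p₁, hF, hp₁, hA⟩ := mem_PSPACE_iff.1 hA
  obtain ⟨K₂, S₂, _, _, G, inp₂, i₂, acc₂, p₂, hG, hp₂, hB⟩ := mem_PSPACE_iff.1 hB
  let eK₁ : K₁ ↪ K₁ ⊕ K₂ ⊕ Bool := Function.Embedding.inl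
  let eK₂ : K₂ ↪ K₁ ⊕ K₂ ⊕ Bool := Function.Embedding.inl.trans Function.Embedding.inr
  let eS₁ : S₁ ↪ S₁ ⊕ S₂ := Function.Embedding.inl
  let eS₂ : S₂ ↪ S₁ ⊕ S₂ := Function.Embedding.inr
  obtain ⟨H, i, inp, hH, h⟩ := Frag.exists_copy i₁ i₂ inp₁ inp₂
  obtain ⟨b, hb⟩ := H.exists_growth
  refine mem_PSPACE_iff.2 ⟨_, _, inferInstance, inferInstance,
    H.seq Set.univ ((F.lift eK₁ eS₁).seq acc₁ (G.lift eK₂ eS₂)), inp, i,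
    Sum.inr '' (Sum.inr '' acc₂), Polynomial.X + Polynomial.C b * (2 * Polynomial.X + 1) + p₁ + p₂,
    hH.seq (hF.lift.seq hG.lift), fun w k c hc => ?_, fun w => ?_⟩
  · obtain ⟨q, s, h1, h2, h2', -⟩ := h w
    have h3 : ∀ {k d}, H.Run k (H.start, single i (w.map inp)) d → ∀ j, (d.2 j).length ≤
        w.length + b * (2 * w.length + 1) := by
      intro k d hd j
      refine (hb hd j).trans (add_le_add ?_ (Nat.mul_le_mul_left b (hH.haltsIn h1 hd).1))
      simpa using single_length_le i j (w.map inp)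
    simp only [Polynomial.eval_add, Polynomial.eval_X, Polynomial.eval_mul, Polynomial.eval_C,
      Polynomial.eval_one, Polynomial.eval_ofNat]
    rcases Frag.run_seq hc (c := (H.start, _)) rfl with
      ⟨d, hd, rfl⟩ | ⟨k₁, d, j, e, hd, hh, -, he, rfl, rfl⟩
    · intro j
      have := h3 hd j
      dsimp only
      omega
    have h3' := fun j => h3 hd j
    obtain rfl := (hH.haltsIn h1 hd).2 hh
    have h4 : ∀ {k d}, (F.lift eK₁ eS₁).Run k (F.start, s) d →
        (∀ j, (d.2 j).length ≤ w.length + b * (2 * w.length + 1) + p₁.eval w.length) ∧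
        ∀ j, d.2 (Sum.inr j) = s (Sum.inr j) := by
      intro k d hd
      obtain ⟨d', h4, -, h5, h6⟩ := Frag.run_lift hd (σ₀ := s) ⟨h2, fun _ _ => rfl⟩
      refine ⟨fun k => ?_, fun j => h6 _ (by simp [eK₁])⟩
      by_cases hk : k ∈ Set.range eK₁
      · obtain ⟨j, rfl⟩ := hk
        rw [h5, List.length_map]
        have := hp₁ _ _ _ h4 j
        omega
      · rw [h6 k hk]
        have := h3' k
        dsimp only at this
        omega
    rcases Frag.run_seq he (c := (F.start, _)) rfl with
      ⟨d, hd', rfl⟩ | ⟨k₂, d, j', e', hd', hh', -, he', rfl, rfl⟩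
    · exact fun j => ((h4 hd').1 j).trans (Nat.le_add_right _ _)
    · obtain ⟨d', h7, -, h8, h9⟩ := Frag.run_lift he' (σ₀ := d.2)
        ⟨fun j => ((h4 hd').2 _).trans (h2' j), fun _ _ => rfl⟩
      intro k
      dsimp only
      by_cases hk : k ∈ Set.range eK₂
      · obtain ⟨j, rfl⟩ := hk
        rw [h8, List.length_map]
        have := hp₂ _ _ _ h7 j
        omega
      · rw [h9 k hk]
        exact ((h4 hd').1 k).trans (Nat.le_add_right _ _)
  · obtain ⟨q, s, ⟨t, -, h1, h1'⟩, h2, h2', -⟩ := h w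
    obtain ⟨k₁, c₁, h3, h4, h5⟩ := hA w
    obtain ⟨k₂, c₂, h6, h7, h8⟩ := hB w
    obtain ⟨s₁, h9, h10⟩ := h3.lift (eK := eK₁) (eS := eS₁) (σ₀ := s) ⟨h2, fun _ _ => rfl⟩
    have h11 : w ∈ A ⊓ B ↔ w ∈ A ∧ w ∈ B := Iff.rfl
    by_cases hw : c₁.1 ∈ acc₁
    · obtain ⟨s₂, h12, h13⟩ := h6.lift (eK := eK₂) (eS := eS₂) (σ₀ := s₁) (σ := s₁)
        ⟨fun j => (h10.2 _ (by simp [eK₁, eK₂])).trans (h2' j), fun _ _ => rfl⟩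
      refine ⟨_, _, h1.seq h1' (Set.mem_univ _) (h9.seq ((Frag.halted_lift h10).2 h4) hw h12),
        Frag.halted_seq_inr.2 (Frag.halted_seq_inr.2 ((Frag.halted_lift h13).2 h7)), ?_⟩
      rw [h11, h5, h8, and_iff_right hw]
      exact (Sum.inr_injective.mem_set_image.trans Sum.inr_injective.mem_set_image).symm
    · refine ⟨_, _, h1.seq h1' (Set.mem_univ _) h9.seq_inl, Frag.halted_seq_inr.2
        (Frag.halted_seq_inl.2 ⟨(Frag.halted_lift h10).2 h4, hw⟩), ?_⟩
      rw [h11, h5]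
      refine iff_of_false (fun h => hw h.1) ?_
      rintro ⟨x, ⟨y, -, rfl⟩, hx⟩
      exact absurd (Sum.inr_injective hx) Sum.inr_ne_inl

end Closure

/-! ## Reading words from right to left -/

instance : Finite Conn := by
  refine Set.finite_univ_iff.1 (Set.Finite.subset (Set.toFinite
    {Conn.top, Conn.zero, Conn.one, Conn.bot, Conn.neg, Conn.par, Conn.tensor, Conn.lolli,
      Conn.amp, Conn.plus}) fun c _ => ?_)
  cases c <;> simp

instance : Finite Token := by
  refine Finite.of_surjective (α := Conn ⊕ Bool ⊕ (Bool × Bool) ⊕ Fin 5) (fun x => match x with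
    | Sum.inl c => Token.conn c
    | Sum.inr (Sum.inl b) => Token.bit b
    | Sum.inr (Sum.inr (Sum.inl b)) => Token.item b.1 b.2
    | Sum.inr (Sum.inr (Sum.inr 0)) => Token.atom
    | Sum.inr (Sum.inr (Sum.inr 1)) => Token.comma
    | Sum.inr (Sum.inr (Sum.inr 2)) => Token.turnstile
    | Sum.inr (Sum.inr (Sum.inr 3)) => Token.tick
    | Sum.inr (Sum.inr (Sum.inr 4)) => Token.player) fun t => ?_
  cases t with
  | conn c => exact ⟨Sum.inl c, rfl⟩
  | bit b => exact ⟨Sum.inr (Sum.inl b), rfl⟩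
  | item p q => exact ⟨Sum.inr (Sum.inr (Sum.inl (p, q))), rfl⟩
  | atom => exact ⟨Sum.inr (Sum.inr (Sum.inr 0)), rfl⟩
  | comma => exact ⟨Sum.inr (Sum.inr (Sum.inr 1)), rfl⟩
  | turnstile => exact ⟨Sum.inr (Sum.inr (Sum.inr 2)), rfl⟩
  | tick => exact ⟨Sum.inr (Sum.inr (Sum.inr 3)), rfl⟩
  | player => exact ⟨Sum.inr (Sum.inr (Sum.inr 4)), rfl⟩

/-- The building blocks of codes of sequents and of games. -/
inductive Block : Type
  | comma (A : Formula)
  | turnstile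
  | tick
  | player (A : Formula)
  | item (p q : Bool) (A : Formula)

namespace Block

/-- The code of a block. -/
def code : Block → List Token
  | comma A => Token.comma :: A.code
  | turnstile => [Token.turnstile]
  | tick => [Token.tick]
  | player A => Token.player :: A.code
  | item p q A => Token.item p q :: A.code

/-- The formula of the block belongs to the language. -/
def InLang (S : Set Conn) : Block → Prop
  | comma A => A.InLang S
  | turnstile => True
  | tick => True
  | player A => A.InLang S
  | item _ _ A => A.InLang S

end Block

/-- The number of arguments of a connective. -/
def Conn.arity : Conn → Fin 3
  | top => 0
  | zero => 0
  | one => 0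
  | bot => 0
  | neg => 1
  | par => 2
  | tensor => 2
  | lolli => 2
  | amp => 2
  | plus => 2

/-- Apply a connective to the first formulas of a list. -/
def Conn.apply : Conn → List Formula → Option (List Formula)
  | top, F => some (.top :: F)
  | zero, F => some (.zero :: F)
  | one, F => some (.one :: F)
  | bot, F => some (.bot :: F)
  | neg, A :: F => some (.neg A :: F)
  | par, A :: B :: F => some (.par A B :: F)
  | tensor, A :: B :: F => some (.tensor A B :: F)
  | lolli, A :: B :: F => some (.lolli A B :: F)
  | amp, A :: B :: F => some (.amp A B :: F)
  | plus, A :: B :: F => some (.plus A B :: F)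
  | _, _ => none

/-- The result of reading a suffix of a word: atom names, formulas and blocks, in the order in
which they occur in the word. -/
structure Parse where
  blocks : List Block
  forms : List Formula
  bits : List Bool

namespace Parse

/-- The suffix that was read. -/
def code (st : Parse) : List Token :=
  st.bits.map Token.bit ++ (st.forms.flatMap Formula.code ++ st.blocks.flatMap Block.code)

open Classical in
/-- Read one more token. -/
noncomputable def push (S : Set Conn) : Token → Parse → Option Parse
  | .bit b, ⟨B, F, w⟩ => some ⟨B, F, b :: w⟩
  | .atom, ⟨B, F, w⟩ => some ⟨B, .atom w :: F, []⟩
  | .conn c, ⟨B, F, []⟩ => if c ∈ S then (c.apply F).map fun F' => ⟨B, F', []⟩ else none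
  | .turnstile, ⟨B, [], []⟩ => some ⟨.turnstile :: B, [], []⟩
  | .tick, ⟨B, [], []⟩ => some ⟨.tick :: B, [], []⟩
  | .comma, ⟨B, [A], []⟩ => some ⟨.comma A :: B, [], []⟩
  | .player, ⟨B, [A], []⟩ => some ⟨.player A :: B, [], []⟩
  | .item p q, ⟨B, [A], []⟩ => some ⟨.item p q A :: B, [], []⟩
  | _, _ => none

/-- Read a word from right to left. -/
noncomputable def read (S : Set Conn) : List Token → Option Parse
  | [] => some ⟨[], [], []⟩
  | t :: w => (read S w).bind (push S t)

variable {S : Set Conn}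

theorem apply_sound {c : Conn} {F F' : List Formula} (h : c.apply F = some F') (hc : c ∈ S)
    (hF : ∀ A ∈ F, A.InLang S) : F'.flatMap Formula.code =
      Token.conn c :: F.flatMap Formula.code ∧ ∀ A ∈ F', A.InLang S := by
  unfold Conn.apply at h
  split at h <;>
    first
    | (simp at h; done)
    | (obtain rfl := Option.some.inj h
       simp_all [Formula.code, Formula.InLang])

theorem push_sound {t : Token} {st st' : Parse} (h : push S t st = some st')
    (hF : ∀ A ∈ st.forms, A.InLang S) (hB : ∀ b ∈ st.blocks, b.InLang S) :
    st'.code = t :: st.code ∧ (∀ A ∈ st'.forms, A.InLang S) ∧ ∀ b ∈ st'.blocks, b.InLang S := by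
  unfold push at h
  split at h
  case h_3 c B F =>
    split_ifs at h with hc
    obtain ⟨F', hF', rfl⟩ := Option.map_eq_some_iff.1 h
    have := apply_sound hF' hc hF
    simp_all [code]
  all_goals
    first
    | (simp at h; done)
    | (obtain rfl := Option.some.inj h
       simp_all [code, Formula.code, Formula.InLang, Block.code, Block.InLang])

/-- Reading loses nothing: the code of the result is the suffix that was read. A result with neither
formulas nor bits left over therefore exhibits the word as a code of blocks. -/
theorem read_sound {w : List Token} {st : Parse} (h : read S w = some st) :
    st.code = w ∧ (∀ A ∈ st.forms, A.InLang S) ∧ ∀ b ∈ st.blocks, b.InLang S := by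
  induction w generalizing st with
  | nil =>
    obtain rfl := Option.some.inj h
    simp [code]
  | cons t w ih =>
    obtain ⟨st', h1, h2⟩ := Option.bind_eq_some_iff.1 h
    obtain ⟨h3, h4, h5⟩ := ih h1
    rw [← h3]
    exact push_sound h2 h4 h5

theorem read_bits {w : List Token} {B : List Block} {F : List Formula} {v : List Bool}
    (h : read S w = some ⟨B, F, v⟩) (u : List Bool) :
    read S (u.map Token.bit ++ w) = some ⟨B, F, u ++ v⟩ := by
  induction u with
  | nil => exact h
  | cons b u ih => simp [read, ih, push]

/-- In prefix notation read backwards, the arguments lie on top of the list of formulas, in the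
right order, when their connective is met. -/
theorem read_formula {A : Formula} (hA : A.InLang S) {w : List Token} {B : List Block}
    {F : List Formula} (h : read S w = some ⟨B, F, []⟩) :
    read S (A.code ++ w) = some ⟨B, A :: F, []⟩ := by
  induction A generalizing w F with
  | atom u => simp [Formula.code, read, read_bits h, push]
  | neg A ih =>
    simp [Formula.code, read, ih hA.2 h, push, show Conn.neg ∈ S from hA.1, Conn.apply]
  | par A A' ih ih' | tensor A A' ih ih' | lolli A A' ih ih' | amp A A' ih ih'
  | plus A A' ih ih' =>
    have h1 := hA.1
    simp [Formula.code, read, ih hA.2.1 (ih' hA.2.2 h), push, h1, Conn.apply]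
  | _ => simp [Formula.code, read, h, push, show _ ∈ S from hA, Conn.apply]

theorem read_blocks {B : List Block} (hB : ∀ b ∈ B, b.InLang S) :
    read S (B.flatMap Block.code) = some ⟨B, [], []⟩ := by
  induction B with
  | nil => rfl
  | cons b B ih =>
    have h1 := ih fun b hb => hB b (List.mem_cons_of_mem _ hb)
    have h2 := hB b List.mem_cons_self
    cases b with
    | tick | turnstile => simp [Block.code, read, h1, push]
    | _ => simp [Block.code, read, read_formula h2 h1, push]

/-- Different lists of blocks have different codes. -/
theorem blocks_injective {B B' : List Block} (h : B.flatMap Block.code = B'.flatMap Block.code) :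
    B = B' := by
  -- With all connectives allowed, reading is a left inverse of coding on every list of blocks.
  have h1 : ∀ A : Formula, A.InLang Set.univ := fun A => by
    induction A <;> simp_all [Formula.InLang]
  have h2 : ∀ b : Block, b.InLang Set.univ := fun b => by cases b <;> simp [Block.InLang, h1]
  have h3 := read_blocks (S := Set.univ) (B := B) fun b _ => h2 b
  rw [h, read_blocks fun b _ => h2 b] at h3
  simpa using h3.symm

end Parse

/-! ### The finite control of the reader -/

/-- The states of a machine that reads a word from right to left. -/
inductive CheckState : Type
  | clean | forms | bits | dead

instance : Finite CheckState := by
  refine Set.finite_univ_iff.1 (Set.Finite.subset (Set.toFinite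
    {CheckState.clean, CheckState.forms, CheckState.bits, CheckState.dead}) fun c _ => ?_)
  cases c <;> simp

/-- The unary representation of a number in which the last symbol is marked. -/
def unary : ℕ → List Token
  | 0 => []
  | 1 => [Token.comma]
  | n + 2 => Token.tick :: unary (n + 1)

/-- Increase the number on a stack with the given top. -/
def incr : Option Token → List Token
  | none => [Token.comma]
  | some x => [Token.tick, x]

open Classical in
/-- The new state, and the word that replaces the top of the counter. -/
noncomputable def checkStep (S : Set Conn) (q : CheckState) (top : Option Token) :
    Token → CheckState × List Token
  | .bit _ => (if q = .dead then .dead else .bits, top.toList)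
  | .atom => (if q = .dead then .dead else .forms, incr top)
  | .conn c => if q = .dead ∨ q = .bits ∨ c ∉ S then (.dead, []) else
      match c.arity, top with
      -- The counter changes by one minus the arity. Any symbol on top shows at least one pending
      -- formula, and `tick` shows at least two.
      | 0, top => (.forms, incr top)
      | 1, some x => (.forms, [x])
      | 2, some .tick => (.forms, [])
      | _, _ => (.dead, [])
  | .turnstile => (if q = .clean then .clean else .dead, top.toList)
  | .tick => (if q = .clean then .clean else .dead, top.toList)
  -- A `comma` on top of the counter means that exactly one formula is pending.
  | .comma => if q = .forms ∧ top = some .comma then (.clean, []) else (.dead, [])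
  | .player => if q = .forms ∧ top = some .comma then (.clean, []) else (.dead, [])
  | .item _ _ => if q = .forms ∧ top = some .comma then (.clean, []) else (.dead, [])

/-- The state of the machine after reading the given suffix. -/
def Parse.control : Parse → CheckState
  | ⟨_, [], []⟩ => .clean
  | ⟨_, _ :: _, []⟩ => .forms
  | ⟨_, _, _ :: _⟩ => .bits

/-- The state and the counter of the machine represent the given result of reading. -/
def Represents (p : Option Parse) (q : CheckState) (c : List Token) : Prop :=
  match p with
  | none => q = .dead
  | some st => q = st.control ∧ c = unary st.forms.length

theorem incr_unary (n : ℕ) : incr (unary n).head? ++ (unary n).tail = unary (n + 1) := by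
  match n with
  | 0 => rfl
  | 1 => rfl
  | n + 2 => rfl

/-- Whether a token can be read depends only on the number of pending formulas and on whether bits
are pending, never on the formulas themselves. Hence a finite control with one counter follows the
reader. Once it is dead, the counter is irrelevant. -/
theorem Represents.push (S : Set Conn) {p : Option Parse} {q : CheckState} {c : List Token}
    (h : Represents p q c) (t : Token) :
    Represents (p.bind (Parse.push S t)) (checkStep S q c.head? t).1
      ((checkStep S q c.head? t).2 ++ c.tail) := by
  cases p with
  | none =>
    obtain rfl : q = .dead := h
    cases t <;> simp [Represents, checkStep]
  | some st =>
    obtain ⟨B, F, w⟩ := st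
    obtain ⟨rfl, rfl⟩ := h
    have h1 : Parse.control ⟨B, F, w⟩ ≠ .dead := by
      cases w <;> cases F <;> simp [Parse.control]
    cases t with
    | bit b =>
      simp only [checkStep, h1, if_false, Frag.toList_head?_append_tail]
      exact ⟨by cases F <;> rfl, rfl⟩
    | atom =>
      simp only [checkStep, h1, if_false, incr_unary]
      exact ⟨rfl, rfl⟩
    | conn c =>
      cases w with
      | cons b w => simp [Represents, checkStep, Parse.push, Parse.control]
      | nil =>
        have h2 : Parse.control ⟨B, F, []⟩ ≠ .bits := by cases F <;> simp [Parse.control]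
        by_cases hc : c ∈ S
        · simp only [checkStep, h1, h2, hc, Option.bind_some, Parse.push, if_true, false_or,
            not_true, if_false]
          match F with
          | [] => cases c <;>
              simp [Conn.arity, Conn.apply, Represents, unary, incr, Parse.control]
          | [A] => cases c <;>
              simp [Conn.arity, Conn.apply, Represents, unary, incr, Parse.control]
          | A :: A' :: F => cases c <;>
              simp [Conn.arity, Conn.apply, Represents, unary, incr, Parse.control]
        · simp [checkStep, hc, Parse.push, Represents]
    | turnstile | tick =>
      cases w <;> cases F <;> simp [Represents, checkStep, Parse.push, Parse.control, unary]
    | _ =>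
      cases w with
      | cons b w => simp [Represents, checkStep, Parse.push, Parse.control]
      | nil =>
        match F with
        | [] => simp [Represents, checkStep, Parse.push, Parse.control, unary]
        | [A] => simp [Represents, checkStep, Parse.push, Parse.control, unary]
        | A :: A' :: F => simp [Represents, checkStep, Parse.push, Parse.control, unary]

/-! ## Transducers on parsed words -/

/-- A finite transducer with an auxiliary stack and three output words. -/
structure Transducer (Q : Type) where
  start : Q
  good : Set Q
  /-- the new state, the word that replaces the top of the auxiliary stack, and the output -/
  step : Q → Option Token → Token → Q × List Token × (Fin 3 → List Token)

namespace Transducer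

variable {Q : Type}

/-- One step on a state, an auxiliary stack and three output words. -/
def next (T : Transducer Q) (r : Q × List Token × (Fin 3 → List Token)) (t : Token) :
    Q × List Token × (Fin 3 → List Token) :=
  ((T.step r.1 r.2.1.head? t).1, (T.step r.1 r.2.1.head? t).2.1 ++ r.2.1.tail,
    fun i => r.2.2 i ++ (T.step r.1 r.2.1.head? t).2.2 i)

/-- The result of reading a word. -/
def run (T : Transducer Q) (w : List Token) : Q × List Token × (Fin 3 → List Token) :=
  w.foldl T.next (T.start, [], fun _ => [])

open Classical in
/-- The output for the result of reading a word. -/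
noncomputable def output (T : Transducer Q) (r : Q × List Token × (Fin 3 → List Token)) :
    List Token :=
  if r.1 ∈ T.good then r.2.2 0 ++ (r.2.2 1 ++ r.2.2 2) else []

open Classical in
/-- The function computed by a transducer: it is applied to codes of lists of blocks. -/
noncomputable def apply (S : Set Conn) (T : Transducer Q) (w : List Token) : List Token :=
  if ∃ B, Parse.read S w = some ⟨B, [], []⟩ then T.output (T.run w) else []

/-! ### A stack machine that computes a transducer -/

/-- The stacks of a machine for a transducer. -/
inductive Stacks : Type
  | inp | tmp | ctr | mid | out
  | o (i : Fin 3)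

instance : Finite Stacks := by
  refine Set.finite_univ_iff.1 (Set.Finite.subset (Set.toFinite
    {Stacks.inp, Stacks.tmp, Stacks.ctr, Stacks.mid, Stacks.out, Stacks.o 0, Stacks.o 1,
      Stacks.o 2}) fun c _ => ?_)
  cases c with
  | o i => fin_cases i <;> simp
  | _ => simp

open Classical in
/-- Check that the word on `tmp`, which is read backwards, is a code of a list of blocks. -/
noncomputable def checker (S : Set Conn) : Frag Stacks Token :=
  Frag.pass .tmp CheckState.clean fun q x t => ((checkStep S q (t .ctr) x).1, fun k =>
    match k with
    | .ctr => (checkStep S q (t .ctr) x).2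
    | .mid => x :: (t .mid).toList
    | k => (t k).toList)

/-- The accepting states of the checker. -/
def accepting (S : Set Conn) : Set (checker S).State := ({CheckState.clean} : Set CheckState)

theorem haltsIn_checker (S : Set Conn) {w : List Token} {s : Stacks → List Token}
    (hs : ∀ k, k ≠ .tmp → s k = []) (hw : s .tmp = w.reverse) :
    ∃ (q : CheckState) (s' : _), (checker S).HaltsIn w.length s q s' ∧
      (q = CheckState.clean ↔ ∃ B, Parse.read S w = some ⟨B, [], []⟩) ∧
      (q = CheckState.clean → s' .ctr = []) ∧ s' .mid = w ∧
      (∀ k, k ≠ .mid → k ≠ .ctr → s' k = []) := by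
  obtain ⟨(q : CheckState), s', h1, h2, h3, h4, h5⟩ := Frag.haltsIn_pass (a := Stacks.tmp)
    (q₀ := CheckState.clean) (δ := fun q x t => ((checkStep S q (t .ctr) x).1, fun k =>
      match k with
      | .ctr => (checkStep S q (t .ctr) x).2
      | .mid => x :: (t .mid).toList
      | k => (t k).toList)) (s := s)
    -- Invariant: the suffix already read is on `mid` in its original order, the control and the
    -- counter represent its parse, and `l` is the rest in reverse.
    (fun l q s => Represents (Parse.read S (s .mid)) q (s .ctr) ∧ w = l.reverse ++ s .mid ∧
      ∀ k, k ≠ .tmp → k ≠ .mid → k ≠ .ctr → s k = []) (by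
      rintro x l q s hs ⟨h1, h2, h3⟩
      refine ⟨?_, ?_, ?_⟩
      · have := h1.push S x
        simpa [Frag.tops, Frag.toList_head?_append_tail, Parse.read] using this
      · simp [Frag.tops, Frag.toList_head?_append_tail, h2]
      · intro k hk1 hk2 hk3
        have := h3 k hk1 hk2 hk3
        cases k <;> simp_all [Frag.tops])
    ⟨by simp [hs, Parse.read, Represents, Parse.control, unary], by simp [hw, hs],
      fun k hk _ _ => hs k hk⟩
  have h6 : s' .mid = w := by simpa using h4.symm
  rw [hw, List.length_reverse] at h1
  rw [h6] at h3
  refine ⟨q, s', h1, ?_, fun hq => ?_, h6, fun k hk1 hk2 => ?_⟩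
  · cases hr : Parse.read S w with
    | none =>
      rw [hr] at h3
      simp [show q = .dead from h3]
    | some st =>
      rw [hr] at h3
      obtain ⟨B, F, v⟩ := st
      rw [h3.1]
      cases v <;> cases F <;> simp [Parse.control]
  · cases hr : Parse.read S w with
    | none =>
      rw [hr] at h3
      simp [show q = .dead from h3] at hq
    | some st =>
      rw [hr] at h3
      obtain ⟨B, F, v⟩ := st
      rw [h3.1] at hq
      rw [h3.2]
      cases v with
      | nil =>
        cases F with
        | nil => rfl
        | cons A F => simp [Parse.control] at hq
      | cons b v => cases F <;> simp [Parse.control] at hq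
  · by_cases hk : k = .tmp
    · rw [hk, h2]
    · exact h5 k hk hk1 hk2

variable [Finite Q] (T : Transducer Q)

open Classical in
/-- Run the transducer on the word on `mid`. -/
noncomputable def runner : Frag Stacks Token :=
  Frag.pass .mid T.start fun q x t => ((T.step q (t .ctr) x).1, fun k =>
    match k with
    | .ctr => (T.step q (t .ctr) x).2.1
    | .o i => ((T.step q (t .ctr) x).2.2 i).reverse ++ (t (.o i)).toList
    | k => (t k).toList)

theorem haltsIn_runner {s : Stacks → List Token} (hs : ∀ k, k ≠ .mid → s k = []) :
    ∃ s', T.runner.HaltsIn (s .mid).length s (T.run (s .mid)).1 s' ∧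
      (∀ i, (s' (.o i)) = ((T.run (s .mid)).2.2 i).reverse) ∧ s' .out = [] := by
  obtain ⟨q, s', h1, h2, pre, h3, h4, h5⟩ := Frag.haltsIn_pass (a := Stacks.mid)
    (q₀ := T.start) (δ := fun q x t => ((T.step q (t .ctr) x).1, fun k =>
      match k with
      | .ctr => (T.step q (t .ctr) x).2.1
      | .o i => ((T.step q (t .ctr) x).2.2 i).reverse ++ (t (.o i)).toList
      | k => (t k).toList)) (s := s)
    -- Invariant: `pre` is the part already consumed; the output stacks hold the outputs for it in
    -- reverse.
    (fun l q s' => ∃ pre, s .mid = pre ++ l ∧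
      T.run pre = (q, s' .ctr, fun i => (s' (.o i)).reverse) ∧ s' .out = []) (by
      rintro x l q s' hs' ⟨pre, h1, h2, h3⟩
      refine ⟨pre ++ [x], by simp [h1], ?_, by simp [Frag.tops, h3]⟩
      rw [run, List.foldl_append, ← run, h2]
      simp [next, Frag.tops, Frag.toList_head?_append_tail])
    ⟨[], rfl, by simp [run, hs], by simp [hs]⟩
  rw [List.append_nil] at h3
  rw [h3, h4]
  rw [h3] at h1
  exact ⟨s', h1, fun i => by simp, h5⟩

open Classical in
/-- Move the word on the given output stack in front of the word on `out`. -/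
noncomputable def drain (i : Fin 3) : Frag Stacks Token :=
  Frag.move (.o i) fun x k => if k = .out then [x] else []

theorem haltsIn_drain (i : Fin 3) (s : Stacks → List Token) :
    ∃ q s', (drain i).HaltsIn (s (.o i)).length s q s' ∧ s' .out = (s (.o i)).reverse ++ s .out ∧
      ∀ j, j ≠ i → s' (.o j) = s (.o j) := by
  classical
  obtain ⟨q, s', h1, -, h2⟩ := Frag.haltsIn_move (a := Stacks.o i)
    (fun x k => if k = .out then [x] else []) s
  refine ⟨q, s', h1, ?_, fun j hj => ?_⟩
  · rw [h2 _ (by simp)]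
    simp
  · rw [h2 _ (by simpa using hj)]
    simp

open Classical in
/-- A machine that computes the function of a transducer. -/
noncomputable def frag (S : Set Conn) : Frag Stacks Token :=
  (Frag.move .inp fun x k => if k = .tmp then [x] else []).seq Set.univ
    ((checker S).seq (accepting S) (T.runner.seq T.good
      ((drain 2).seq Set.univ ((drain 1).seq Set.univ (drain 0)))))

/-- The input is reversed, checked, run through the transducer, and the three outputs are collected.
If the check or the final state fails, the machine stops with `out` still empty, which is the
default value of the function. -/
theorem polyTimeComputable_apply (S : Set Conn) : PolyTimeComputable (T.apply S) := by
  classical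
  obtain ⟨b, hb⟩ := T.runner.exists_growth
  refine polyTimeComputable_iff.2 ⟨Stacks, Token, inferInstance, inferInstance, T.frag S,
    Function.Embedding.refl _, .inp, .out, Function.Embedding.refl _,
    Polynomial.X + 1 + (Polynomial.X + 1 + (Polynomial.X + 1 +
      (Polynomial.C b * Polynomial.X + 1 + (Polynomial.C b * Polynomial.X + 1 +
        Polynomial.C b * Polynomial.X)))),
    Frag.det_move.seq (Frag.Det.seq Frag.det_pass (Frag.Det.seq Frag.det_pass
      (Frag.Det.seq Frag.det_move (Frag.Det.seq Frag.det_move Frag.det_move)))), fun w => ?_⟩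
  have hid : ∀ w : List Token, w.map (Function.Embedding.refl Token) = w := List.map_id
  rw [hid, hid]
  simp only [Polynomial.eval_add, Polynomial.eval_X, Polynomial.eval_mul, Polynomial.eval_C,
    Polynomial.eval_one]
  obtain ⟨q₁, s₁, h1, h2, h3⟩ := Frag.haltsIn_move (a := Stacks.inp)
    (fun x k => if k = .tmp then [x] else []) (single .inp w)
  rw [show single Stacks.inp w .inp = w by simp [single]] at h1 h3
  have h4 : s₁ .tmp = w.reverse := by
    rw [h3 _ (by simp)]
    simp [single]
  have h5 : ∀ k, k ≠ .tmp → s₁ k = [] := by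
    intro k hk
    by_cases hk' : k = .inp
    · rw [hk', h2]
    · rw [h3 k hk']
      simp [single, hk, hk']
  obtain ⟨q₂, s₂, h6, h7, h8, h9, h10⟩ := haltsIn_checker S h5 h4
  by_cases hB : ∃ B, Parse.read S w = some ⟨B, [], []⟩
  swap
  · have h11 := h1.seq (Set.mem_univ _) (h6.seq_of_notMem (A := accepting S)
      (G := T.runner.seq T.good ((drain 2).seq Set.univ ((drain 1).seq Set.univ (drain 0))))
      (fun h => hB (h7.1 h)))
    refine ⟨_, s₂, h11.mono (by omega), ?_⟩
    rw [h10 _ (by simp) (by simp), apply, if_neg hB]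
  have hq := h7.2 hB
  have h11 : ∀ k, k ≠ .mid → s₂ k = [] := by
    intro k hk
    by_cases hk' : k = .ctr
    · rw [hk', h8 hq]
    · exact h10 k hk hk'
  obtain ⟨s₃, h12, h13, h14⟩ := T.haltsIn_runner h11
  rw [h9] at h12 h13
  rw [apply, if_pos hB, output]
  by_cases hg : (T.run w).1 ∈ T.good
  swap
  · have h15 := h1.seq (Set.mem_univ _) (h6.seq (A := accepting S) hq
      (h12.seq_of_notMem (G := (drain 2).seq Set.univ ((drain 1).seq Set.univ (drain 0))) hg))
    refine ⟨_, s₃, h15.mono (by omega), ?_⟩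
    rw [if_neg hg, h14]
  have h15 : ∀ i, (s₃ (.o i)).length ≤ b * w.length := by
    intro i
    obtain ⟨t, ht, h16, -⟩ := h12
    have h17 := hb h16 (.o i)
    dsimp only at h17
    rw [h11 (.o i) (by simp)] at h17
    have := Nat.mul_le_mul_left b ht
    simp only [List.length_nil, zero_add] at h17
    exact h17.trans this
  -- The outputs are drained in the order 2, 1, 0, since what is pushed last comes first. Draining
  -- also undoes their reversal.
  obtain ⟨q₄, s₄, h16, h17, h18⟩ := haltsIn_drain 2 s₃
  obtain ⟨q₅, s₅, h19, h20, h21⟩ := haltsIn_drain 1 s₄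
  obtain ⟨q₆, s₆, h22, h23, -⟩ := haltsIn_drain 0 s₅
  have h24 : s₄ (.o 1) = s₃ (.o 1) := h18 1 (by simp)
  have h25 : s₅ (.o 0) = s₃ (.o 0) := (h21 0 (by simp)).trans (h18 0 (by simp))
  have h26 := h1.seq (Set.mem_univ _) (h6.seq (A := accepting S) hq
      (h12.seq hg (h16.seq (Set.mem_univ _) (h19.seq (Set.mem_univ _) h22))))
  refine ⟨_, s₆, h26.mono ?_, ?_⟩
  · have e0 := h15 0
    have e1 := h15 1
    have e2 := h15 2
    rw [h24, h25]
    omega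
  · rw [if_pos hg, h23, h20, h17, h14, h24, h25, h13, h13, h13]
    simp

end Transducer

/-! ## Proof theory -/

namespace Formula

/-- Substitution of formulas for atoms. -/
def subst (σ : List Bool → Formula) : Formula → Formula
  | atom w => σ w
  | top => top
  | zero => zero
  | one => one
  | bot => bot
  | neg A => neg (A.subst σ)
  | par A B => par (A.subst σ) (B.subst σ)
  | tensor A B => tensor (A.subst σ) (B.subst σ)
  | lolli A B => lolli (A.subst σ) (B.subst σ)
  | amp A B => amp (A.subst σ) (B.subst σ)
  | plus A B => plus (A.subst σ) (B.subst σ)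

theorem InLang.subst {S : Set Conn} {σ : List Bool → Formula} (hσ : ∀ w, (σ w).InLang S)
    {A : Formula} (hA : A.InLang S) : (A.subst σ).InLang S := by
  induction A with
  | atom w => exact hσ w
  | neg A ih => exact ⟨hA.1, ih hA.2⟩
  | par A B ih ih' | tensor A B ih ih' | lolli A B ih ih' | amp A B ih ih' | plus A B ih ih' =>
    exact ⟨hA.1, ih hA.2.1, ih' hA.2.2⟩
  | _ => exact hA

theorem subst_subst (σ τ : List Bool → Formula) (A : Formula) :
    (A.subst σ).subst τ = A.subst fun w => (σ w).subst τ := by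
  induction A <;> simp_all [Formula.subst]

theorem subst_atom (A : Formula) : A.subst atom = A := by
  induction A <;> simp_all [Formula.subst]

/-- The two-valued interpretation in which all atoms are false. -/
def Holds : Formula → Prop
  | atom _ => False
  | top => True
  | zero => False
  | one => True
  | bot => False
  | neg A => ¬ A.Holds
  | par A B => A.Holds ∨ B.Holds
  | tensor A B => A.Holds ∧ B.Holds
  | lolli A B => A.Holds → B.Holds
  | amp A B => A.Holds ∧ B.Holds
  | plus A B => A.Holds ∨ B.Holds

end Formula

namespace ResourceLogic

variable {L : ResourceLogic}

theorem Provable.isSequent {Γ Δ : Multiset Formula} (h : L.Provable Γ Δ) : L.IsSequent Γ Δ := by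
  cases h <;> assumption

theorem IsSequent.subst {σ : List Bool → Formula} (hσ : ∀ w, (σ w).InLang L.conn)
    {Γ Δ : Multiset Formula} (h : L.IsSequent Γ Δ) :
    L.IsSequent (Γ.map (Formula.subst σ)) (Δ.map (Formula.subst σ)) := by
  obtain ⟨h1, h2, h3⟩ := h
  refine ⟨fun A hA => ?_, fun A hA => ?_, fun hi => by simpa using h3 hi⟩
  · obtain ⟨B, hB, rfl⟩ := Multiset.mem_map.1 hA
    exact (h1 B hB).subst hσ
  · obtain ⟨B, hB, rfl⟩ := Multiset.mem_map.1 hA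
    exact (h2 B hB).subst hσ

/-- The rules are schematic in their formulas, and apart from affinity their only side condition is
that the conclusion is a sequent of `L`. -/
theorem Provable.subst {σ : List Bool → Formula} (hσ : ∀ w, (σ w).InLang L.conn)
    {Γ Δ : Multiset Formula} (h : L.Provable Γ Δ) :
    L.Provable (Γ.map (Formula.subst σ)) (Δ.map (Formula.subst σ)) := by
  have hs := h.isSequent.subst hσ
  induction h with
  | ax A => exact .ax _ (by simpa using hs)
  | cut Γ Γ' Δ Δ' A _ h₁ h₂ ih₁ ih₂ =>
    have i₁ := ih₁ (h₁.isSequent.subst hσ)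
    have i₂ := ih₂ (h₂.isSequent.subst hσ)
    simp only [Multiset.map_cons, Multiset.map_add] at *
    exact .cut _ _ _ _ _ hs i₁ i₂
  | weakL Γ Δ A haff _ h ih =>
    have i := ih (h.isSequent.subst hσ)
    simp only [Multiset.map_cons] at *
    exact .weakL _ _ _ haff hs i
  | weakR Γ Δ A haff _ h ih =>
    have i := ih (h.isSequent.subst hσ)
    simp only [Multiset.map_cons] at *
    exact .weakR _ _ _ haff hs i
  | negL Γ Δ A _ h ih =>
    have i := ih (h.isSequent.subst hσ)
    simp only [Multiset.map_cons] at *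
    exact .negL _ _ _ hs i
  | negR Γ Δ A _ h ih =>
    have i := ih (h.isSequent.subst hσ)
    simp only [Multiset.map_cons] at *
    exact .negR _ _ _ hs i
  | tensorR Γ Γ' Δ Δ' A B _ h₁ h₂ ih₁ ih₂ =>
    have i₁ := ih₁ (h₁.isSequent.subst hσ)
    have i₂ := ih₂ (h₂.isSequent.subst hσ)
    simp only [Multiset.map_cons, Multiset.map_add] at *
    exact .tensorR _ _ _ _ _ _ hs i₁ i₂
  | tensorL Γ Δ A B _ h ih =>
    have i := ih (h.isSequent.subst hσ)
    simp only [Multiset.map_cons] at *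
    exact .tensorL _ _ _ _ hs i
  | parL Γ Γ' Δ Δ' A B _ h₁ h₂ ih₁ ih₂ =>
    have i₁ := ih₁ (h₁.isSequent.subst hσ)
    have i₂ := ih₂ (h₂.isSequent.subst hσ)
    simp only [Multiset.map_cons, Multiset.map_add] at *
    exact .parL _ _ _ _ _ _ hs i₁ i₂
  | parR Γ Δ A B _ h ih =>
    have i := ih (h.isSequent.subst hσ)
    simp only [Multiset.map_cons] at *
    exact .parR _ _ _ _ hs i
  | lolliL Γ Γ' Δ Δ' A B _ h₁ h₂ ih₁ ih₂ =>
    have i₁ := ih₁ (h₁.isSequent.subst hσ)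
    have i₂ := ih₂ (h₂.isSequent.subst hσ)
    simp only [Multiset.map_cons, Multiset.map_add] at *
    exact .lolliL _ _ _ _ _ _ hs i₁ i₂
  | lolliR Γ Δ A B _ h ih =>
    have i := ih (h.isSequent.subst hσ)
    simp only [Multiset.map_cons] at *
    exact .lolliR _ _ _ _ hs i
  | oneL Γ Δ _ h ih =>
    have i := ih (h.isSequent.subst hσ)
    simp only [Multiset.map_cons] at *
    exact .oneL _ _ hs i
  | oneR => exact .oneR (by simpa [Formula.subst] using hs)
  | botL => exact .botL (by simpa [Formula.subst] using hs)
  | botR Γ Δ _ h ih =>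
    have i := ih (h.isSequent.subst hσ)
    simp only [Multiset.map_cons] at *
    exact .botR _ _ hs i
  | ampR Γ Δ A B _ h₁ h₂ ih₁ ih₂ =>
    have i₁ := ih₁ (h₁.isSequent.subst hσ)
    have i₂ := ih₂ (h₂.isSequent.subst hσ)
    simp only [Multiset.map_cons] at *
    exact .ampR _ _ _ _ hs i₁ i₂
  | ampL₀ Γ Δ A B _ h ih =>
    have i := ih (h.isSequent.subst hσ)
    simp only [Multiset.map_cons] at *
    exact .ampL₀ _ _ _ _ hs i
  | ampL₁ Γ Δ A B _ h ih =>
    have i := ih (h.isSequent.subst hσ)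
    simp only [Multiset.map_cons] at *
    exact .ampL₁ _ _ _ _ hs i
  | plusL Γ Δ A B _ h₁ h₂ ih₁ ih₂ =>
    have i₁ := ih₁ (h₁.isSequent.subst hσ)
    have i₂ := ih₂ (h₂.isSequent.subst hσ)
    simp only [Multiset.map_cons] at *
    exact .plusL _ _ _ _ hs i₁ i₂
  | plusR₀ Γ Δ A B _ h ih =>
    have i := ih (h.isSequent.subst hσ)
    simp only [Multiset.map_cons] at *
    exact .plusR₀ _ _ _ _ hs i
  | plusR₁ Γ Δ A B _ h ih =>
    have i := ih (h.isSequent.subst hσ)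
    simp only [Multiset.map_cons] at *
    exact .plusR₁ _ _ _ _ hs i
  | topR Γ Δ _ =>
    simp only [Multiset.map_cons] at *
    exact .topR _ _ hs
  | zeroL Γ Δ _ =>
    simp only [Multiset.map_cons] at *
    exact .zeroL _ _ hs

/-- The two-valued interpretation is sound. -/
theorem Provable.holds {Γ Δ : Multiset Formula} (h : L.Provable Γ Δ)
    (hΓ : ∀ A ∈ Γ, A.Holds) : ∃ A ∈ Δ, A.Holds := by
  induction h with
  | _ => simp_all [Formula.Holds] <;> grind

/-- The atom is false in the two-valued model. This settles the games in which nothing is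
contributed to an outcome. -/
theorem not_provable_atom (w : List Bool) : ¬ L.Provable 0 {Formula.atom w} := by
  intro h
  obtain ⟨A, hA, h1⟩ := h.holds (by simp)
  obtain rfl := Multiset.mem_singleton.1 hA
  exact h1

/-! ### Invertible rules and currying -/

theorem isSequent_cons_left {Γ Δ : Multiset Formula} {A : Formula} :
    L.IsSequent (A ::ₘ Γ) Δ ↔ A.InLang L.conn ∧ L.IsSequent Γ Δ := by
  simp only [IsSequent, Multiset.forall_mem_cons]
  tauto

theorem inLang_lolli {A B : Formula} :
    (A.lolli B).InLang L.conn ↔ A.InLang L.conn ∧ B.InLang L.conn := by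
  simp [Formula.InLang, L.lolli_mem]

/-- Linear implication internalises the left side of a sequent. -/
theorem provable_lolli_iff {Γ : Multiset Formula} {A B : Formula} (hA : A.InLang L.conn)
    (hB : B.InLang L.conn) : L.Provable Γ {A.lolli B} ↔ L.Provable (A ::ₘ Γ) {B} := by
  have hAB : (A.lolli B).InLang L.conn := inLang_lolli.2 ⟨hA, hB⟩
  constructor
  · intro h
    have hΓ := h.isSequent.1
    -- Modus ponens, `A ⊸ B, A ⊢ B`; cutting it against the hypothesis inverts the right rule.
    have h1 : L.Provable (A.lolli B ::ₘ ({A} + 0)) (0 + {B}) := by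
      refine .lolliL {A} 0 0 {B} A B ?_ (.ax A ?_) (.ax B ?_) <;>
        simp [IsSequent, hA, hB, hAB]
    have h2 : L.Provable ({A} + Γ) ({B} + 0) := by
      refine .cut {A} Γ {B} 0 (A.lolli B) ?_ (by simpa using h1) (by simpa using h)
      simp only [IsSequent, Multiset.singleton_add, Multiset.forall_mem_cons]
      exact ⟨⟨hA, hΓ⟩, by simpa using hB, by simp⟩
    simpa using h2
  · intro h
    refine .lolliR Γ 0 A B ?_ (by simpa using h)
    exact ⟨(isSequent_cons_left.1 h.isSequent).2.1, by simpa using hAB, by simp⟩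

/-- Negation moves a formula to the other side of a sequent. -/
theorem provable_neg_iff (hL : ¬ L.intuitionistic) {Γ Δ : Multiset Formula} {A : Formula}
    (hA : A.InLang L.conn) : L.Provable (A.neg ::ₘ Γ) Δ ↔ L.Provable Γ (A ::ₘ Δ) := by
  have hn : A.neg.InLang L.conn := ⟨L.neg_mem hL, hA⟩
  constructor
  · intro h
    have hs := h.isSequent
    -- Excluded middle, `⊢ ∼A, A`, which is cut against the hypothesis.
    have h1 : L.Provable 0 (A.neg ::ₘ {A}) := by
      refine .negR 0 {A} A ?_ (.ax A ?_) <;> simp [IsSequent, hA, hn, hL]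
    have h2 : L.Provable (Γ + 0) (Δ + {A}) := by
      refine .cut Γ 0 Δ {A} A.neg ?_ h h1
      obtain ⟨h3, h4, -⟩ := hs
      simp only [Multiset.forall_mem_cons] at h3
      refine ⟨by simpa using h3.2, ?_, fun h => (hL h).elim⟩
      intro B hB
      rcases Multiset.mem_add.1 hB with hB | hB
      · exact h4 B hB
      · rwa [Multiset.mem_singleton.1 hB]
    rw [add_zero, add_comm, Multiset.singleton_add] at h2
    exact h2
  · intro h
    refine .negL Γ Δ A ?_ h
    obtain ⟨h3, h4, -⟩ := h.isSequent
    simp only [Multiset.forall_mem_cons] at h4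
    exact ⟨by simpa [hn] using h3, h4.2, fun h => (hL h).elim⟩

/-- The formula `∼1` stands in for `⊥`, which a classical fragment need not contain. It turns an
empty right side into a single formula. -/
theorem provable_neg_one_iff (hL : ¬ L.intuitionistic) {Γ : Multiset Formula} :
    L.Provable Γ {Formula.one.neg} ↔ L.Provable Γ 0 := by
  have h1 : Formula.one.InLang L.conn := L.one_mem
  have hn : Formula.one.neg.InLang L.conn := ⟨L.neg_mem hL, h1⟩
  constructor
  · intro h
    have h2 : L.Provable {Formula.one.neg} 0 := by
      refine .negL 0 0 .one ?_ (.oneR ?_) <;> simp [IsSequent, h1, hn, hL]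
    have h3 : L.Provable (0 + Γ) (0 + 0) :=
      .cut 0 Γ 0 0 Formula.one.neg ⟨by simpa using h.isSequent.1, by simp, fun h => (hL h).elim⟩
        h2 (by simpa using h)
    simpa using h3
  · intro h
    refine .negR Γ 0 .one ⟨h.isSequent.1, by simpa using hn, fun h => (hL h).elim⟩
      (.oneL Γ 0 ⟨?_, by simp, fun h => (hL h).elim⟩ h)
    simpa [h1] using h.isSequent.1

/-- The implication with the given premises. -/
def curry (Γ : List Formula) (B : Formula) : Formula := Γ.foldr Formula.lolli B

theorem inLang_curry {Γ : List Formula} {B : Formula} :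
    (curry Γ B).InLang L.conn ↔ (∀ A ∈ Γ, A.InLang L.conn) ∧ B.InLang L.conn := by
  induction Γ with
  | nil => simp [curry]
  | cons A Γ ih =>
    have : curry (A :: Γ) B = A.lolli (curry Γ B) := rfl
    rw [this, inLang_lolli, ih, List.forall_mem_cons, and_assoc]

theorem provable_curry_iff {Γ : List Formula} {B : Formula} (hΓ : ∀ A ∈ Γ, A.InLang L.conn)
    (hB : B.InLang L.conn) (Γ' : Multiset Formula) :
    L.Provable Γ' {curry Γ B} ↔ L.Provable ((Γ : Multiset Formula) + Γ') {B} := by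
  induction Γ generalizing Γ' with
  | nil => simp [curry]
  | cons A Γ ih =>
    rw [List.forall_mem_cons] at hΓ
    refine (provable_lolli_iff (B := curry Γ B) hΓ.1 (inLang_curry.2 ⟨hΓ.2, hB⟩)).trans ?_
    rw [ih hΓ.2, ← Multiset.cons_coe, Multiset.cons_add, Multiset.add_cons]

end ResourceLogic

/-! ## From games to sequents -/

/-- The tokens that occur in codes of formulas. -/
def Token.InFormula : Token → Prop
  | conn _ => True
  | atom => True
  | bit _ => True
  | _ => False

theorem Formula.inFormula_code (A : Formula) : ∀ t ∈ A.code, t.InFormula := by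
  induction A <;> simp_all [Formula.code, Token.InFormula, or_imp, forall_and]

namespace Transducer

variable {Q : Type} (T : Transducer Q)

/-- The result of reading a word from a given configuration. -/
def steps (r : Q × List Token × (Fin 3 → List Token)) (w : List Token) :
    Q × List Token × (Fin 3 → List Token) :=
  w.foldl T.next r

theorem steps_append (r) (w w' : List Token) : T.steps r (w ++ w') = T.steps (T.steps r w) w' :=
  List.foldl_append

theorem steps_cons (r) (t : Token) (w : List Token) :
    T.steps r (t :: w) = T.steps (T.next r t) w := rfl

theorem steps_eq_of_absorbing {q : Q} (hq : ∀ top t, (T.step q top t).1 = q)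
    {r : Q × List Token × (Fin 3 → List Token)} (hr : r.1 = q) (w : List Token) :
    (T.steps r w).1 = q := by
  induction w generalizing r with
  | nil => exact hr
  | cons t w ih => exact ih (by simp only [next, hr, hq])

/-- In a state in which formulas are copied to output words, a code of a formula is copied. -/
theorem steps_formula {q : Q} {e : Token → Fin 3 → List Token}
    (hq : ∀ top t, t.InFormula → T.step q top t = (q, top.toList, e t))
    (c : List Token) (o : Fin 3 → List Token) (A : Formula) :
    T.steps (q, c, o) A.code = (q, c, fun i => o i ++ A.code.flatMap fun t => e t i) := by
  -- A suffix of a code of a formula need not be such a code, so the induction runs over all words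
  -- of formula tokens.
  have key : ∀ (w : List Token) (o : Fin 3 → List Token), (∀ t ∈ w, t.InFormula) →
      T.steps (q, c, o) w = (q, c, fun i => o i ++ w.flatMap fun t => e t i) := by
    intro w
    induction w with
    | nil => simp [steps]
    | cons t w ih =>
      intro o hw
      rw [List.forall_mem_cons] at hw
      rw [steps_cons]
      simp only [next, hq _ _ hw.1, Frag.toList_head?_append_tail]
      rw [ih _ hw.2]
      simp
  exact key _ _ A.inFormula_code

end Transducer

/-- The states of the transducer that extracts a sequent from a game: `found` says whether the
goal of the chosen player was seen, and `target` where the current formula is copied. -/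
inductive ExtractState : Type
  | start
  | read (found : Bool) (target : Option (Fin 3))
  | bad

instance : Finite ExtractState := by
  refine Finite.of_surjective (α := Option (Option (Bool × Option (Fin 3)))) (fun x => match x with
    | none => .bad
    | some none => .start
    | some (some (f, m)) => .read f m) fun q => ?_
  cases q with
  | bad => exact ⟨none, rfl⟩
  | start => exact ⟨some none, rfl⟩
  | read f m => exact ⟨some (some (f, m)), rfl⟩

/-- The word `w` on one of the output words. -/
def emit (m : Option (Fin 3)) (w : List Token) : Fin 3 → List Token :=
  fun i => if m = some i then w else []

/-- The mark of a resource for the first or the second profile. -/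
def MarkedResource.mark (b : Bool) (r : MarkedResource) : Bool := if b then r.inP else r.inQ

/-- One step of the transducer that extracts a sequent from a game. -/
def extractStep (b : Bool) : ExtractState → Option Token → Token →
    ExtractState × List Token × (Fin 3 → List Token)
  -- The ticks are stored on the auxiliary stack and each player removes one; the player who meets
  -- the empty stack is the chosen one. Output 1 collects the contributions and output 2 the
  -- turnstile with the goal. They are kept apart because later players contribute after the goal
  -- has been read.
  | .start, top, .tick => (.start, Token.tick :: top.toList, emit none [])
  | .start, none, .player => (.read true (some 2), [], emit (some 2) [.turnstile, .comma])
  | .start, some _, .player => (.read false none, [], emit none [])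
  | .read false _, none, .player => (.read true (some 2), [], emit (some 2) [.turnstile, .comma])
  | .read false _, some _, .player => (.read false none, [], emit none [])
  | .read true _, top, .player => (.read true none, top.toList, emit none [])
  | .read f _, top, .item p q => if (if b then p else q) = true
      then (.read f (some 1), top.toList, emit (some 1) [.comma])
      else (.read f none, top.toList, emit none [])
  | .read f m, top, .conn c => (.read f m, top.toList, emit m [.conn c])
  | .read f m, top, .atom => (.read f m, top.toList, emit m [.atom])
  | .read f m, top, .bit x => (.read f m, top.toList, emit m [.bit x])
  | _, top, _ => (.bad, top.toList, emit none [])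

/-- The transducer that extracts from a game and two profiles the sequent that says that the goal
of the chosen player is provable from the outcome of the first or second profile. -/
def extract (b : Bool) : Transducer ExtractState where
  start := .start
  good := {q | ∃ m, q = .read true m}
  step := extractStep b

/-- The contributions of the players to the first or second profile. -/
def contribution (b : Bool) (ps : List (Formula × List MarkedResource)) : List Formula :=
  ps.flatMap fun p => (p.2.filter (MarkedResource.mark b)).map MarkedResource.res

/-- The code of the instance with chosen player `i` and the given players. -/
def gameCode (i : ℕ) (ps : List (Formula × List MarkedResource)) : List Token :=
  List.replicate i Token.tick ++ ps.flatMap fun p => playerCode p.1 p.2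

/-- The blocks of the code of a player. -/
def itemBlocks (l : List MarkedResource) : List Block :=
  l.map fun r => Block.item r.inP r.inQ r.res

/-- The blocks of the code of a list of players. -/
def playerBlocks (ps : List (Formula × List MarkedResource)) : List Block :=
  ps.flatMap fun p => Block.player p.1 :: itemBlocks p.2

theorem code_itemBlocks (l : List MarkedResource) : (itemBlocks l).flatMap Block.code =
    l.flatMap fun r => Token.item r.inP r.inQ :: r.res.code := by
  simp [itemBlocks, List.flatMap_map, Block.code]

theorem code_playerBlocks (ps : List (Formula × List MarkedResource)) :
    (playerBlocks ps).flatMap Block.code = ps.flatMap fun p => playerCode p.1 p.2 := by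
  simp [playerBlocks, List.flatMap_assoc, code_itemBlocks, Block.code, playerCode]

theorem code_gameBlocks (i : ℕ) (ps : List (Formula × List MarkedResource)) :
    (List.replicate i Block.tick ++ playerBlocks ps).flatMap Block.code = gameCode i ps := by
  rw [List.flatMap_append, code_playerBlocks, gameCode]
  congr 1
  induction i with
  | zero => rfl
  | succ i ih => simp [List.replicate_succ, Block.code, ih]

/-- All formulas of the players belong to the language. -/
def PlayersInLang (S : Set Conn) (ps : List (Formula × List MarkedResource)) : Prop :=
  ∀ p ∈ ps, p.1.InLang S ∧ ∀ r ∈ p.2, r.res.InLang S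

theorem inLang_gameBlocks {S : Set Conn} {i : ℕ} {ps : List (Formula × List MarkedResource)} :
    (∀ b ∈ List.replicate i Block.tick ++ playerBlocks ps, b.InLang S) ↔ PlayersInLang S ps := by
  constructor
  · intro h p hp
    refine ⟨h (.player p.1) ?_, fun r hr => h (.item r.inP r.inQ r.res) ?_⟩
    · exact List.mem_append_right _ (List.mem_flatMap.2 ⟨p, hp, List.mem_cons_self⟩)
    · exact List.mem_append_right _ (List.mem_flatMap.2 ⟨p, hp, List.mem_cons_of_mem _
        (List.mem_map.2 ⟨r, hr, rfl⟩)⟩)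
  · intro h b hb
    rcases List.mem_append.1 hb with hb | hb
    · rw [List.eq_of_mem_replicate hb]
      trivial
    · obtain ⟨p, hp, hb⟩ := List.mem_flatMap.1 hb
      rcases List.mem_cons.1 hb with rfl | hb
      · exact (h p hp).1
      · obtain ⟨r, hr, rfl⟩ := List.mem_map.1 hb
        exact (h p hp).2 r hr

/-! ### Correctness of the extraction of a sequent -/

section Extract

variable (b : Bool)

theorem extract_formula (f : Bool) (m : Option (Fin 3)) (c : List Token)
    (o : Fin 3 → List Token) (A : Formula) :
    (extract b).steps (ExtractState.read f m, c, o) A.code =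
      (ExtractState.read f m, c, fun i => o i ++ emit m A.code i) := by
  rw [(extract b).steps_formula (q := ExtractState.read f m) (e := fun t => emit m [t])]
  · congr 2
    funext i
    by_cases h : m = some i <;> simp [emit, h]
  · intro top t ht
    cases t <;> cases f <;> cases top <;> first | rfl | exact False.elim ht

theorem extract_items (f : Bool) (m : Option (Fin 3)) (c : List Token)
    (o : Fin 3 → List Token) (l : List MarkedResource) :
    ∃ m', (extract b).steps (ExtractState.read f m, c, o)
        (l.flatMap fun r => Token.item r.inP r.inQ :: r.res.code) =
      (ExtractState.read f m', c, fun i => o i ++ emit (some 1)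
        (((l.filter (MarkedResource.mark b)).map MarkedResource.res).flatMap fun A =>
          Token.comma :: A.code) i) := by
  induction l generalizing m o with
  | nil => exact ⟨m, by simp [Transducer.steps, emit]⟩
  | cons r l ih =>
    rw [List.flatMap_cons, List.cons_append, Transducer.steps_cons, Transducer.steps_append]
    by_cases h : r.mark b = true
    · have h1 : (extract b).next (ExtractState.read f m, c, o) (.item r.inP r.inQ) =
          (ExtractState.read f (some 1), c, fun i => o i ++ emit (some 1) [.comma] i) := by
        have h2 : (if b then r.inP else r.inQ) = true := h
        cases f <;> simp [Transducer.next, extract, extractStep, h2, Frag.toList_head?_append_tail]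
      rw [h1, extract_formula]
      obtain ⟨m', hm'⟩ := ih (some 1)
        (fun i => o i ++ emit (some 1) [.comma] i ++ emit (some 1) r.res.code i)
      refine ⟨m', hm'.trans ?_⟩
      congr 2
      funext i
      by_cases hi : i = 1
      · simp [emit, hi, h]
      · have : ¬ 1 = i := fun h => hi h.symm
        simp [emit, this]
    · have h1 : (extract b).next (ExtractState.read f m, c, o) (.item r.inP r.inQ) =
          (ExtractState.read f none, c, o) := by
        have h2 : ¬ (if b then r.inP else r.inQ) = true := h
        cases f <;> simp [Transducer.next, extract, extractStep, h2, Frag.toList_head?_append_tail,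
          emit]
      rw [h1, extract_formula]
      obtain ⟨m', hm'⟩ := ih none (fun i => o i ++ emit none r.res.code i)
      refine ⟨m', hm'.trans ?_⟩
      congr 2
      funext i
      simp [emit, h]

theorem extract_players_found (m : Option (Fin 3)) (c : List Token) (o : Fin 3 → List Token)
    (ps : List (Formula × List MarkedResource)) :
    ∃ m', (extract b).steps (ExtractState.read true m, c, o)
        (ps.flatMap fun p => playerCode p.1 p.2) =
      (ExtractState.read true m', c, fun i => o i ++ emit (some 1)
        ((contribution b ps).flatMap fun A => Token.comma :: A.code) i) := by
  induction ps generalizing m o with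
  | nil => exact ⟨m, by simp [Transducer.steps, emit, contribution]⟩
  | cons p ps ih =>
    have h1 : (extract b).next (ExtractState.read true m, c, o) .player =
        (ExtractState.read true none, c, o) := by
      simp [Transducer.next, extract, extractStep, Frag.toList_head?_append_tail, emit]
    rw [List.flatMap_cons, playerCode, List.cons_append, Transducer.steps_cons, h1,
      Transducer.steps_append, Transducer.steps_append, extract_formula]
    obtain ⟨m₁, h2⟩ := extract_items b true none c (fun i => o i ++ emit none p.1.code i) p.2
    rw [h2]
    obtain ⟨m₂, h3⟩ := ih m₁ _
    refine ⟨m₂, h3.trans ?_⟩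
    congr 2
    funext i
    by_cases hi : 1 = i <;> simp [emit, hi, contribution]

/-- The states in which the goal of the chosen player was not yet seen. -/
def ExtractState.Searching : ExtractState → Prop
  | .start => True
  | .read false _ => True
  | _ => False

/-- Induction on the players, each of whom uses up one tick. The second half says that an index
beyond the last player leaves the search unfinished, so that the final state is not good. -/
theorem extract_players {q : ExtractState} (hq : q.Searching) (i : ℕ) (o : Fin 3 → List Token)
    (ps : List (Formula × List MarkedResource)) :
    (∀ h : i < ps.length, ∃ m' c, (extract b).steps (q, List.replicate i Token.tick, o)
        (ps.flatMap fun p => playerCode p.1 p.2) =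
      (ExtractState.read true m', c, fun j => o j ++ (emit (some 1)
        ((contribution b ps).flatMap fun A => Token.comma :: A.code) j ++
          emit (some 2) (.turnstile :: .comma :: ps[i].1.code) j))) ∧
    (¬ i < ps.length → ExtractState.Searching ((extract b).steps
      (q, List.replicate i Token.tick, o) (ps.flatMap fun p => playerCode p.1 p.2)).1) := by
  induction ps generalizing q i o with
  | nil => exact ⟨fun h => by simp at h, fun _ => hq⟩
  | cons p ps ih =>
    rw [List.flatMap_cons, playerCode, List.cons_append, Transducer.steps_cons,
      Transducer.steps_append, Transducer.steps_append]
    cases i with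
    | zero =>
      refine ⟨fun _ => ?_, fun h => by simp at h⟩
      have h1 : (extract b).next (q, List.replicate 0 Token.tick, o) .player =
          (ExtractState.read true (some 2), [], fun j => o j ++
            emit (some 2) [.turnstile, .comma] j) := by
        match q, hq with
        | .start, _ => simp [Transducer.next, extract, extractStep]
        | .read false _, _ => simp [Transducer.next, extract, extractStep]
      rw [h1, extract_formula]
      obtain ⟨m₁, h2⟩ := extract_items b true (some 2) []
        (fun j => o j ++ emit (some 2) [.turnstile, .comma] j ++ emit (some 2) p.1.code j) p.2
      rw [h2]
      obtain ⟨m₂, h3⟩ := extract_players_found b m₁ [] (fun j => o j ++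
        emit (some 2) [.turnstile, .comma] j ++ emit (some 2) p.1.code j ++ emit (some 1)
        (((p.2.filter (MarkedResource.mark b)).map MarkedResource.res).flatMap fun A =>
          Token.comma :: A.code) j) ps
      refine ⟨m₂, [], h3.trans ?_⟩
      congr 2
      funext j
      fin_cases j <;> simp [emit, contribution]
    | succ i =>
      have h1 : (extract b).next (q, List.replicate (i + 1) Token.tick, o) .player =
          (ExtractState.read false none, List.replicate i Token.tick, o) := by
        match q, hq with
        | .start, _ => simp [Transducer.next, extract, extractStep, List.replicate_succ, emit]
        | .read false _, _ =>
          simp [Transducer.next, extract, extractStep, List.replicate_succ, emit]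
      rw [h1, extract_formula]
      obtain ⟨m₁, h2⟩ := extract_items b false none (List.replicate i Token.tick)
        (fun j => o j ++ emit none p.1.code j) p.2
      rw [h2]
      obtain ⟨h3, h4⟩ := ih (q := .read false m₁) trivial i (fun j => o j ++
        emit none p.1.code j ++ emit (some 1)
        (((p.2.filter (MarkedResource.mark b)).map MarkedResource.res).flatMap fun A =>
          Token.comma :: A.code) j)
      refine ⟨fun h => ?_, fun h => h4 (by simpa using h)⟩
      obtain ⟨m', c, h5⟩ := h3 (by simpa using h)
      refine ⟨m', c, h5.trans ?_⟩
      congr 2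
      funext j
      by_cases hi : 1 = j <;> simp [emit, hi, contribution]

theorem extract_ticks (i n : ℕ) (o : Fin 3 → List Token) :
    (extract b).steps (ExtractState.start, List.replicate n Token.tick, o)
      (List.replicate i Token.tick) =
        (ExtractState.start, List.replicate (n + i) Token.tick, o) := by
  induction i generalizing n with
  | zero => rfl
  | succ i ih =>
    have h1 : (extract b).next (ExtractState.start, List.replicate n Token.tick, o) .tick =
        (ExtractState.start, List.replicate (n + 1) Token.tick, o) := by
      simp [Transducer.next, extract, extractStep, emit, List.replicate_succ,
        Frag.toList_head?_append_tail, -List.tail_replicate]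
    rw [List.replicate_succ, Transducer.steps_cons, h1, ih, add_assoc, add_comm 1 i]

theorem run_extract (i : ℕ) (ps : List (Formula × List MarkedResource)) :
    (extract b).run (gameCode i ps) = (extract b).steps (ExtractState.start,
      List.replicate i Token.tick, fun _ => []) (ps.flatMap fun p => playerCode p.1 p.2) := by
  have h := extract_ticks b i 0 (fun _ => [])
  rw [zero_add] at h
  rw [← h]
  exact List.foldl_append

theorem apply_extract {S : Set Conn} {i : ℕ} {ps : List (Formula × List MarkedResource)}
    (hps : PlayersInLang S ps) (hi : i < ps.length) :
    (extract b).apply S (gameCode i ps) = sequentCode (contribution b ps) [ps[i].1] := by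
  obtain ⟨m, c, h⟩ := (extract_players b (q := .start) trivial i (fun _ => []) ps).1 hi
  rw [Transducer.apply, if_pos, Transducer.output, run_extract, h, if_pos]
  · simp [emit, sequentCode]
  · exact ⟨m, rfl⟩
  · refine ⟨List.replicate i Block.tick ++ playerBlocks ps, ?_⟩
    rw [← code_gameBlocks]
    exact Parse.read_blocks (inLang_gameBlocks.2 hps)

theorem steps_bad {r} (hr : r.1 = ExtractState.bad) (w : List Token) :
    ((extract b).steps r w).1 = ExtractState.bad := by
  refine (extract b).steps_eq_of_absorbing (q := ExtractState.bad) (fun top t => ?_) hr w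
  cases t <;> cases top <;> rfl

/-- After the first player, only items and players avoid the absorbing state `bad`, so a surviving
sequence of blocks is the rest of a list of players. -/
theorem exists_items_of_steps {f : Bool} {m : Option (Fin 3)} {c : List Token}
    {o : Fin 3 → List Token} {B : List Block}
    (h : ((extract b).steps (ExtractState.read f m, c, o) (B.flatMap Block.code)).1 ≠
      ExtractState.bad) : ∃ l ps, B = itemBlocks l ++ playerBlocks ps := by
  induction B generalizing f m c o with
  | nil => exact ⟨[], [], rfl⟩
  | cons x B ih =>
    rw [List.flatMap_cons, Transducer.steps_append] at h
    cases x with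
    | item p q A =>
      have h1 : ∃ m' o', (extract b).next (ExtractState.read f m, c, o) (.item p q) =
          (ExtractState.read f m', c, o') := by
        by_cases h2 : (if b then p else q) = true <;> cases f <;>
          simp [Transducer.next, extract, extractStep, h2, Frag.toList_head?_append_tail]
      obtain ⟨m', o', h1⟩ := h1
      rw [Block.code, Transducer.steps_cons, h1, extract_formula] at h
      obtain ⟨l, ps, rfl⟩ := ih h
      exact ⟨⟨A, p, q⟩ :: l, ps, rfl⟩
    | player A =>
      have h1 : ∃ f' m' c' o', (extract b).next (ExtractState.read f m, c, o) .player =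
          (ExtractState.read f' m', c', o') := by
        cases f <;> cases c <;> simp [Transducer.next, extract, extractStep]
      obtain ⟨f', m', c', o', h1⟩ := h1
      rw [Block.code, Transducer.steps_cons, h1, extract_formula] at h
      obtain ⟨l, ps, rfl⟩ := ih h
      exact ⟨[], (A, l) :: ps, by simp [playerBlocks, itemBlocks]⟩
    | _ =>
      refine (h (steps_bad b ?_ _)).elim
      rw [Block.code, Transducer.steps_cons]
      refine steps_bad b ?_ _
      cases f <;> cases c <;> rfl

theorem exists_game_of_steps {c : List Token} {o : Fin 3 → List Token} {B : List Block}
    (h : ((extract b).steps (ExtractState.start, c, o) (B.flatMap Block.code)).1 ≠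
      ExtractState.bad) : ∃ i ps, B = List.replicate i Block.tick ++ playerBlocks ps := by
  induction B generalizing c o with
  | nil => exact ⟨0, [], rfl⟩
  | cons x B ih =>
    rw [List.flatMap_cons, Transducer.steps_append] at h
    cases x with
    | tick =>
      obtain ⟨i, ps, rfl⟩ := ih h
      exact ⟨i + 1, ps, by simp [List.replicate_succ]⟩
    | player A =>
      have h1 : ∃ f' m' c' o', (extract b).next (ExtractState.start, c, o) .player =
          (ExtractState.read f' m', c', o') := by
        cases c <;> simp [Transducer.next, extract, extractStep]
      obtain ⟨f', m', c', o', h1⟩ := h1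
      rw [Block.code, Transducer.steps_cons, h1, extract_formula] at h
      obtain ⟨l, ps, rfl⟩ := exists_items_of_steps b h
      exact ⟨0, (A, l) :: ps, by simp [playerBlocks]⟩
    | _ =>
      refine (h (steps_bad b ?_ _)).elim
      rw [Block.code, Transducer.steps_cons]
      refine steps_bad b ?_ _
      cases c <;> rfl

/-- A nonempty output certifies all that makes the word an instance: the check gives blocks with
formulas of the language, avoiding `bad` gives their shape, and a good final state gives the range
of the index. -/
theorem exists_game_of_apply_ne_nil {S : Set Conn} {w : List Token}
    (h : (extract b).apply S w ≠ []) :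
    ∃ i ps, w = gameCode i ps ∧ PlayersInLang S ps ∧ i < ps.length := by
  rw [Transducer.apply] at h
  split_ifs at h with hB
  · obtain ⟨B, hB⟩ := hB
    obtain ⟨h1, -, h2⟩ := Parse.read_sound hB
    have h3 : w = B.flatMap Block.code := by simpa [Parse.code] using h1.symm
    rw [Transducer.output] at h
    split_ifs at h with hg
    · have h4 : ((extract b).run w).1 ≠ ExtractState.bad := by
        obtain ⟨m, hm⟩ := hg
        rw [hm]
        exact ExtractState.noConfusion
      rw [h3] at h4
      obtain ⟨i, ps, rfl⟩ := exists_game_of_steps b h4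
      rw [code_gameBlocks] at h3
      refine ⟨i, ps, h3, inLang_gameBlocks.1 h2, ?_⟩
      by_contra hi
      have h5 := (extract_players b (q := .start) trivial i (fun _ => []) ps).2 hi
      rw [← run_extract, ← h3] at h5
      obtain ⟨m, hm⟩ := hg
      rw [hm] at h5
      exact h5
    · exact (h rfl).elim
  · exact (h rfl).elim

end Extract

/-! ### The codes of sequents -/

/-- The blocks of the code of a sequent. -/
def sequentBlocks (Γ Δ : List Formula) : List Block :=
  Γ.map Block.comma ++ Block.turnstile :: Δ.map Block.comma

theorem code_sequentBlocks (Γ Δ : List Formula) :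
    (sequentBlocks Γ Δ).flatMap Block.code = sequentCode Γ Δ := by
  simp [sequentBlocks, sequentCode, List.flatMap_map, Block.code]

theorem sequentBlocks_injective {Γ Δ Γ' Δ' : List Formula}
    (h : sequentBlocks Γ Δ = sequentBlocks Γ' Δ') : Γ = Γ' ∧ Δ = Δ' := by
  have hc : Function.Injective Block.comma := fun A B h => by simpa using h
  induction Γ generalizing Γ' with
  | nil =>
    cases Γ' with
    | nil => simpa [sequentBlocks, hc.list_map.eq_iff] using h
    | cons A Γ' => simp [sequentBlocks] at h
  | cons A Γ ih =>
    cases Γ' with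
    | nil => simp [sequentBlocks] at h
    | cons B Γ' =>
      simp only [sequentBlocks, List.map_cons, List.cons_append, List.cons.injEq,
        Block.comma.injEq] at h
      obtain ⟨rfl, rfl⟩ := ih h.2
      simp [h.1]

/-- Unique readability: the sequent witnessing membership must be the given one. -/
theorem sequentCode_mem_iff {L : ResourceLogic} {Γ Δ : List Formula} :
    sequentCode Γ Δ ∈ sequentValidity L ↔
      L.Provable (Γ : Multiset Formula) (Δ : Multiset Formula) := by
  constructor
  · rintro ⟨Γ', Δ', h1, h2⟩
    rw [← code_sequentBlocks, ← code_sequentBlocks] at h1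
    obtain ⟨rfl, rfl⟩ := sequentBlocks_injective (Parse.blocks_injective h1)
    exact h2
  · exact fun h => ⟨Γ, Δ, rfl, h⟩

theorem nil_notMem_sequentValidity (L : ResourceLogic) : [] ∉ sequentValidity L := by
  rintro ⟨Γ, Δ, h, -⟩
  simp [sequentCode] at h

/-! ### Preferences and sequents -/

theorem sum_coe_ofFn {n : ℕ} (f : Fin n → List Formula) :
    ∑ i, (f i : Multiset Formula) = ((List.ofFn f).flatten : Multiset Formula) := by
  induction n with
  | zero => simp
  | succ n ih =>
    rw [Fin.sum_univ_succ, List.ofFn_succ, List.flatten_cons, ← Multiset.coe_add, ih]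

/-- Games and profiles are replaced by lists of goals with marked resources. The marks determine
both profiles, and the sublists they select are contained in the endowments. -/
theorem mem_dichotomousPreference_iff {L : ResourceLogic} {w : List Token} :
    w ∈ dichotomousPreference L ↔ ∃ i ps, ∃ h : i < ps.length, w = gameCode i ps ∧
      PlayersInLang L.conn ps ∧ L.Provable (contribution true ps) {ps[i].1} ∧
      ¬ L.Provable (contribution false ps) {ps[i].1} := by
  constructor
  · rintro ⟨G, P, Q, i, ⟨l, hl, rfl⟩, h1, h2⟩
    have hP : (contribution true (List.ofFn fun j => (G.goal j, l j)) : Multiset Formula) =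
        G.outcome P := by
      rw [ResourceGame.outcome, contribution, List.flatMap_def, List.map_ofFn, ← sum_coe_ofFn]
      exact Finset.sum_congr rfl fun j _ => (hl j).2.1
    have hQ : (contribution false (List.ofFn fun j => (G.goal j, l j)) : Multiset Formula) =
        G.outcome Q := by
      rw [ResourceGame.outcome, contribution, List.flatMap_def, List.map_ofFn, ← sum_coe_ofFn]
      exact Finset.sum_congr rfl fun j _ => (hl j).2.2
    refine ⟨i, List.ofFn fun j => (G.goal j, l j), by simp, ?_, ?_, ?_, ?_⟩
    · rw [gameCode, List.flatMap_def, List.map_ofFn]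
      rfl
    · intro p hp
      obtain ⟨j, rfl⟩ := List.mem_ofFn.1 hp
      refine ⟨G.goal_inLang j, fun r hr => G.endow_inLang j _ ?_⟩
      rw [← (hl j).1]
      exact Multiset.mem_coe.2 (List.mem_map.2 ⟨r, hr, rfl⟩)
    · rw [hP]
      simpa using h1
    · rw [hQ]
      simpa using h2
  · rintro ⟨i, ps, hi, rfl, hps, h1, h2⟩
    have hle : ∀ (l : List MarkedResource) (f : MarkedResource → Bool),
        ((l.filter f).map MarkedResource.res : Multiset Formula) ≤ l.map MarkedResource.res :=
      fun l f => Multiset.coe_le.2 (List.filter_sublist.map _).subperm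
    let G : ResourceGame L :=
      { n := ps.length
        goal := fun j => ps[j].1
        endow := fun j => (ps[j].2.map MarkedResource.res : Multiset Formula)
        goal_inLang := fun j => (hps _ (List.getElem_mem _)).1
        endow_inLang := fun j A hA => by
          obtain ⟨r, hr, rfl⟩ := List.mem_map.1 (Multiset.mem_coe.1 hA)
          exact (hps _ (List.getElem_mem _)).2 r hr }
    let P : Bool → G.Profile := fun b j =>
      ⟨((ps[j].2.filter (MarkedResource.mark b)).map MarkedResource.res : Multiset Formula),
        hle _ _⟩
    have hP : ∀ b, G.outcome (P b) = (contribution b ps : Multiset Formula) := by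
      intro b
      rw [ResourceGame.outcome, contribution, List.flatMap_def]
      refine (sum_coe_ofFn (n := ps.length) fun j => (ps[j].2.filter
        (MarkedResource.mark b)).map MarkedResource.res).trans ?_
      conv_rhs => rw [← List.ofFn_getElem (xs := ps), List.map_ofFn]
      rfl
    refine ⟨G, P true, P false, ⟨i, hi⟩, ⟨fun j => ps[j].2, fun j => ⟨rfl, rfl, rfl⟩, ?_⟩, ?_, ?_⟩
    · rw [gameCode, List.flatMap_def]
      congr 2
      conv_lhs => rw [← List.ofFn_getElem (xs := ps), List.map_ofFn]
      rfl
    · rw [hP]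
      exact h1
    · rw [hP]
      exact h2

/-- On a word that is no instance both outputs are empty. The first conjunct then fails, while the
second would hold; it is the first that excludes such words. -/
theorem gameCode_mem_iff {L : ResourceLogic} {w : List Token} :
    w ∈ dichotomousPreference L ↔ (extract true).apply L.conn w ∈ sequentValidity L ∧
      (extract false).apply L.conn w ∉ sequentValidity L := by
  constructor
  · rw [mem_dichotomousPreference_iff]
    rintro ⟨i, ps, hi, rfl, hps, h1, h2⟩
    rw [apply_extract _ hps hi, apply_extract _ hps hi, sequentCode_mem_iff, sequentCode_mem_iff]
    exact ⟨h1, h2⟩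
  · rintro ⟨h1, h2⟩
    have h3 : (extract true).apply L.conn w ≠ [] := fun h =>
      nil_notMem_sequentValidity L (h ▸ h1)
    obtain ⟨i, ps, rfl, hps, hi⟩ := exists_game_of_apply_ne_nil true h3
    rw [apply_extract _ hps hi, sequentCode_mem_iff] at h1 h2
    exact mem_dichotomousPreference_iff.2 ⟨i, ps, hi, rfl, hps, h1, h2⟩

/-! ## From sequents to games -/

namespace ResourceLogic

variable (L : ResourceLogic)

open Classical in
/-- The conclusion of the formula of a sequent with the given right side. -/
noncomputable def conclusion (Δ : List Formula) : Formula :=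
  -- The default `1` is never reached for an intuitionistic sequent, whose right side is a single
  -- formula. In the classical case the right side becomes a list of negated premises of `∼1`.
  if L.intuitionistic then Δ.headD .one else curry (Δ.map Formula.neg) Formula.one.neg

/-- A formula that is provable if and only if the sequent is. -/
noncomputable def sequentFormula (Γ Δ : List Formula) : Formula := curry Γ (L.conclusion Δ)

variable {L}

theorem provable_map_neg_iff (hL : ¬ L.intuitionistic) {Δ : List Formula}
    (hΔ : ∀ A ∈ Δ, A.InLang L.conn) (Γ Δ' : Multiset Formula) :
    L.Provable ((Δ.map Formula.neg : Multiset Formula) + Γ) Δ' ↔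
      L.Provable Γ ((Δ : Multiset Formula) + Δ') := by
  induction Δ generalizing Δ' with
  | nil => simp
  | cons A Δ ih =>
    rw [List.forall_mem_cons] at hΔ
    rw [List.map_cons, ← Multiset.cons_coe, Multiset.cons_add, provable_neg_iff hL hΔ.1,
      ih hΔ.2, ← Multiset.cons_coe, Multiset.cons_add, Multiset.add_cons]

theorem inLang_conclusion {Γ Δ : List Formula} (hs : L.IsSequent Γ Δ) :
    (L.conclusion Δ).InLang L.conn := by
  rw [conclusion]
  split_ifs with hL
  · have h1 := hs.2.2 hL
    match Δ, hs with
    | [], _ => exact L.one_mem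
    | A :: _, hs => exact hs.2.1 A (by simp)
  · refine inLang_curry.2 ⟨fun A hA => ?_, L.neg_mem hL, L.one_mem⟩
    obtain ⟨B, hB, rfl⟩ := List.mem_map.1 hA
    exact ⟨L.neg_mem hL, hs.2.1 B (by simpa using hB)⟩

theorem inLang_sequentFormula {Γ Δ : List Formula} (hs : L.IsSequent Γ Δ) :
    (L.sequentFormula Γ Δ).InLang L.conn :=
  inLang_curry.2 ⟨fun A hA => hs.1 A (by simpa using hA), inLang_conclusion hs⟩

theorem provable_sequentFormula_iff {Γ Δ : List Formula} (hs : L.IsSequent Γ Δ) :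
    L.Provable 0 {L.sequentFormula Γ Δ} ↔ L.Provable Γ Δ := by
  have hΓ : ∀ A ∈ Γ, A.InLang L.conn := fun A hA => hs.1 A (by simpa using hA)
  have hΔ : ∀ A ∈ Δ, A.InLang L.conn := fun A hA => hs.2.1 A (by simpa using hA)
  rw [sequentFormula, provable_curry_iff hΓ (inLang_conclusion hs), add_zero, conclusion]
  split_ifs with hL
  · obtain ⟨A, hA⟩ := Multiset.card_eq_one.1 (hs.2.2 hL)
    obtain rfl := Multiset.coe_eq_singleton.1 hA
    simp
  · have h1 : ∀ A ∈ Δ.map Formula.neg, A.InLang L.conn := by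
      intro A hA
      obtain ⟨B, hB, rfl⟩ := List.mem_map.1 hA
      exact ⟨L.neg_mem hL, hΔ B hB⟩
    have h2 : Formula.one.neg.InLang L.conn := ⟨L.neg_mem hL, L.one_mem⟩
    rw [provable_curry_iff h1 h2, provable_neg_one_iff hL, provable_map_neg_iff hL hΔ, add_zero]

end ResourceLogic

/-! ### A fresh atom as a test of provability -/

/-- Rename the atoms so that the atom with the empty name does not occur. -/
def Formula.rename (A : Formula) : Formula := A.subst fun w => .atom (true :: w)

/-- The atom with the empty name. -/
def freshAtom : Formula := .atom []

namespace ResourceLogic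

variable {L : ResourceLogic}

theorem inLang_rename {A : Formula} (hA : A.InLang L.conn) : A.rename.InLang L.conn :=
  Formula.InLang.subst (σ := fun w => .atom (true :: w)) (fun _ => trivial) hA

/-- A formula is provable if and only if it can be used to get a fresh atom. -/
theorem provable_rename_lolli_iff {A : Formula} (hA : A.InLang L.conn) :
    L.Provable {A.rename.lolli freshAtom} {freshAtom} ↔ L.Provable 0 {A} := by
  have hp : freshAtom.InLang L.conn := trivial
  constructor
  · intro h
    -- This substitution undoes the renaming and puts `A` for the fresh atom, so that the hypothesis
    -- becomes `A ⊸ A ⊢ A`.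
    let σ : List Bool → Formula := fun w => match w with
      | [] => A
      | _ :: w => .atom w
    have hσ : ∀ w, (σ w).InLang L.conn := by
      intro w
      cases w
      · exact hA
      · trivial
    have h1 := h.subst hσ
    have h2 : A.rename.subst σ = A := by
      rw [Formula.rename, Formula.subst_subst]
      exact A.subst_atom
    have h3 : freshAtom.subst σ = A := rfl
    rw [Multiset.map_singleton, Multiset.map_singleton, Formula.subst, h2, h3] at h1
    have h4 : L.Provable 0 {A.lolli A} := (provable_lolli_iff hA hA).2 (.ax A (by
      simp [IsSequent, hA]))
    have h5 : L.Provable (0 + 0) ({A} + 0) := by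
      refine .cut 0 0 {A} 0 (A.lolli A) (by simp [IsSequent, hA]) (by simpa using h1)
        (by simpa using h4)
    simpa using h5
  · intro h
    have h1 : L.Provable 0 {A.rename} := by
      simpa [Formula.rename] using h.subst (σ := fun w => .atom (true :: w)) fun _ => trivial
    have h2 : L.Provable (A.rename.lolli freshAtom ::ₘ (0 + 0)) (0 + {freshAtom}) := by
      refine .lolliL 0 0 0 {freshAtom} _ _ ?_ (by simpa using h1) (.ax _ ?_)
      · simp [IsSequent, inLang_lolli, inLang_rename hA, hp]
      · simp [IsSequent, hp]
    simpa using h2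

end ResourceLogic

/-- The code of the renamed formula, token by token. -/
def Token.rename : Token → List Token
  | .atom => [.atom, .bit true]
  | t => [t]

/-- The bit added to a name stands directly behind its `atom` token, so renaming acts token by token
and needs no memory. -/
theorem Formula.code_rename (A : Formula) : A.rename.code = A.code.flatMap Token.rename := by
  induction A with
  | atom w =>
    have : ∀ u : List Bool, (u.map Token.bit).flatMap Token.rename = u.map Token.bit := by
      intro u
      induction u with
      | nil => rfl
      | cons b u ih => simpa [Token.rename] using ih
    simp [Formula.rename, Formula.subst, Formula.code, Token.rename, this]
  | _ => simp_all [Formula.rename, Formula.subst, Formula.code, Token.rename]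

theorem rename_curry (Γ : List Formula) (B : Formula) :
    (ResourceLogic.curry Γ B).rename = ResourceLogic.curry (Γ.map Formula.rename) B.rename := by
  induction Γ with
  | nil => rfl
  | cons A Γ ih => exact congrArg (Formula.lolli A.rename) ih

theorem code_curry (Γ : List Formula) (B : Formula) : (ResourceLogic.curry Γ B).code =
    Γ.flatMap (fun A => Token.conn .lolli :: A.code) ++ B.code := by
  induction Γ with
  | nil => rfl
  | cons A Γ ih =>
    change Token.conn .lolli :: (A.code ++ (ResourceLogic.curry Γ B).code) = _
    rw [ih]
    simp

/-! ### The transducer -/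

/-- The states of the transducer that turns a sequent into a player. -/
inductive ItemState : Type
  | left
  | right (nonempty : Bool)
  | bad

instance : Finite ItemState := by
  refine Set.finite_univ_iff.1 (Set.Finite.subset (Set.toFinite
    {ItemState.left, ItemState.right false, ItemState.right true, ItemState.bad}) fun c _ => ?_)
  cases c with
  | right k => cases k <;> simp
  | _ => simp

/-- One step of the transducer that turns a sequent into a player whose only resource is marked
by `b` and its negation; `int` says whether the logic is intuitionistic. -/
def itemStep (int b : Bool) : ItemState → Option Token → Token →
    ItemState × List Token × (Fin 3 → List Token)
  | .left, top, .comma => (.left, top.toList, emit (some 1) [.conn .lolli])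
  -- Output 0 is the beginning of the player, up to the outer implication. Output 1 collects the
  -- premises, and in the intuitionistic case also the conclusion. Output 2 is the end: the fresh
  -- atom, preceded in the classical case by `∼1`.
  | .left, top, .turnstile => (.right false, top.toList, fun i => if i = 0 then
      [.player, .atom, .item b !b, .conn .lolli] else if i = 1 then [] else
      if int then [.atom] else [.conn .neg, .conn .one, .atom])
  | .right k, top, .comma => if int then (if k then .bad else .right true, top.toList, emit none [])
      else (.right true, top.toList, emit (some 1) [.conn .lolli, .conn .neg])
  | .bad, top, _ => (.bad, top.toList, emit none [])
  | q, top, .conn c => (q, top.toList, emit (some 1) (Token.conn c).rename)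
  | q, top, .atom => (q, top.toList, emit (some 1) Token.atom.rename)
  | q, top, .bit x => (q, top.toList, emit (some 1) (Token.bit x).rename)
  | _, top, _ => (.bad, top.toList, emit none [])

/-- The transducer that turns a sequent into a player whose goal is the fresh atom. -/
def itemise (int b : Bool) : Transducer ItemState where
  start := .left
  -- An intuitionistic sequent must have shown one formula on the right; a second one has already
  -- led to `bad`.
  good := {q | ∃ k, q = .right k ∧ (int = true → k = true)}
  step := itemStep int b

/-! ### Correctness of the translation of a sequent into a player -/

section Itemise

variable (int b : Bool)

theorem itemise_formula {q : ItemState} (hq : q ≠ .bad) (c : List Token)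
    (o : Fin 3 → List Token) (A : Formula) :
    (itemise int b).steps (q, c, o) A.code =
      (q, c, fun i => o i ++ emit (some 1) A.rename.code i) := by
  rw [(itemise int b).steps_formula (q := q) (e := fun t => emit (some 1) t.rename),
    A.code_rename]
  · congr 2
    funext i
    by_cases h : 1 = i <;> simp [emit, h]
  · intro top t ht
    cases q <;> cases t <;> first | rfl | exact False.elim ht | exact (hq rfl).elim

theorem itemise_left (c : List Token) (o : Fin 3 → List Token) (Γ : List Formula) :
    (itemise int b).steps (ItemState.left, c, o) (Γ.flatMap fun A => Token.comma :: A.code) =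
      (ItemState.left, c, fun i => o i ++ emit (some 1)
        (Γ.flatMap fun A => Token.conn .lolli :: A.rename.code) i) := by
  induction Γ generalizing o with
  | nil => simp [Transducer.steps, emit]
  | cons A Γ ih =>
    have h1 : (itemise int b).next (ItemState.left, c, o) .comma =
        (ItemState.left, c, fun i => o i ++ emit (some 1) [.conn .lolli] i) := by
      simp [Transducer.next, itemise, itemStep, Frag.toList_head?_append_tail]
    rw [List.flatMap_cons, List.cons_append, Transducer.steps_cons, h1, Transducer.steps_append,
      itemise_formula int b (by simp), ih]
    congr 2
    funext i
    by_cases h : 1 = i <;> simp [emit, h]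

theorem itemise_right (k : Bool) (c : List Token) (o : Fin 3 → List Token) (Δ : List Formula) :
    (itemise false b).steps (ItemState.right k, c, o) (Δ.flatMap fun A => Token.comma :: A.code) =
      (ItemState.right (k || !Δ.isEmpty), c, fun i => o i ++ emit (some 1)
        (Δ.flatMap fun A => Token.conn .lolli :: Token.conn .neg :: A.rename.code) i) := by
  induction Δ generalizing k o with
  | nil => simp [Transducer.steps, emit]
  | cons A Δ ih =>
    have h1 : (itemise false b).next (ItemState.right k, c, o) .comma =
        (ItemState.right true, c, fun i => o i ++ emit (some 1) [.conn .lolli, .conn .neg] i) := by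
      simp [Transducer.next, itemise, itemStep, Frag.toList_head?_append_tail]
    rw [List.flatMap_cons, List.cons_append, Transducer.steps_cons, h1, Transducer.steps_append,
      itemise_formula false b (by simp), ih]
    simp only [Bool.true_or, List.isEmpty_cons, Bool.not_false, Bool.or_true]
    congr 2
    funext i
    by_cases h : 1 = i <;> simp [emit, h]

theorem itemise_right_singleton (c : List Token) (o : Fin 3 → List Token) (A : Formula) :
    (itemise true b).steps (ItemState.right false, c, o) (Token.comma :: A.code) =
      (ItemState.right true, c, fun i => o i ++ emit (some 1) A.rename.code i) := by
  have h1 : (itemise true b).next (ItemState.right false, c, o) .comma =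
      (ItemState.right true, c, o) := by
    simp [Transducer.next, itemise, itemStep, Frag.toList_head?_append_tail, emit]
  rw [Transducer.steps_cons, h1, itemise_formula true b (by simp)]

theorem itemise_steps_bad {r} (hr : r.1 = ItemState.bad) (w : List Token) :
    ((itemise int b).steps r w).1 = ItemState.bad := by
  refine (itemise int b).steps_eq_of_absorbing (q := ItemState.bad) (fun top t => ?_) hr w
  cases t <;> rfl

theorem exists_right_of_steps {k : Bool} {c : List Token} {o : Fin 3 → List Token}
    {B : List Block} (h : ((itemise int b).steps (ItemState.right k, c, o)
      (B.flatMap Block.code)).1 ≠ ItemState.bad) :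
    ∃ Δ, B = Δ.map Block.comma ∧ (int = true → k = true → Δ = []) := by
  induction B generalizing k c o with
  | nil => exact ⟨[], rfl, fun _ _ => rfl⟩
  | cons x B ih =>
    rw [List.flatMap_cons, Transducer.steps_append] at h
    cases x with
    | comma A =>
      by_cases hk : int = true ∧ k = true
      · refine (h (itemise_steps_bad int b ?_ _)).elim
        rw [Block.code, Transducer.steps_cons]
        refine itemise_steps_bad int b ?_ _
        simp [Transducer.next, itemise, itemStep, hk]
      · have h1 : ∃ c' o', (itemise int b).next (ItemState.right k, c, o) .comma =
            (ItemState.right true, c', o') := by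
          cases int <;> cases k <;> simp [Transducer.next, itemise, itemStep] at hk ⊢
        obtain ⟨c', o', h1⟩ := h1
        rw [Block.code, Transducer.steps_cons, h1, itemise_formula int b (by simp)] at h
        obtain ⟨Δ, rfl, -⟩ := ih h
        exact ⟨A :: Δ, rfl, fun h1 h2 => (hk ⟨h1, h2⟩).elim⟩
    | _ =>
      refine (h (itemise_steps_bad int b ?_ _)).elim
      rw [Block.code, Transducer.steps_cons]
      exact itemise_steps_bad int b rfl _

theorem length_le_one_of_steps {c : List Token} {o : Fin 3 → List Token}
    {Δ : List Formula} (h : ((itemise true b).steps (ItemState.right false, c, o)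
      ((Δ.map Block.comma).flatMap Block.code)).1 ∈ (itemise true b).good) : Δ.length = 1 := by
  obtain ⟨k, hk, hk'⟩ := h
  obtain rfl := hk' rfl
  cases Δ with
  | nil => simp [Transducer.steps] at hk
  | cons A Δ =>
    rw [List.map_cons, List.flatMap_cons, Transducer.steps_append, Block.code,
      itemise_right_singleton] at hk
    obtain ⟨Δ', h1, h2⟩ := exists_right_of_steps true b (k := true) (by rw [hk]; simp)
    obtain rfl := h2 rfl rfl
    simp only [List.map_nil, List.map_eq_nil_iff] at h1
    simp [h1]

/-- Ending in a good state forces exactly one turnstile among `comma` blocks, and in the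
intuitionistic case one formula behind it. Words that code no sequent thus give the empty output. -/
theorem exists_sequent_of_steps {c : List Token} {o : Fin 3 → List Token} {B : List Block}
    (h : ((itemise int b).steps (ItemState.left, c, o) (B.flatMap Block.code)).1 ∈
      (itemise int b).good) :
    ∃ Γ Δ, B = sequentBlocks Γ Δ ∧ (int = true → Δ.length = 1) := by
  have hbad : ((itemise int b).steps (ItemState.left, c, o) (B.flatMap Block.code)).1 ≠
      ItemState.bad := by
    obtain ⟨k, hk, -⟩ := h
    rw [hk]
    exact ItemState.noConfusion
  induction B generalizing c o with
  | nil =>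
    obtain ⟨k, hk, -⟩ := h
    exact absurd hk (by simp [Transducer.steps])
  | cons x B ih =>
    rw [List.flatMap_cons, Transducer.steps_append] at h hbad
    cases x with
    | comma A =>
      have h1 : ∃ c' o', (itemise int b).next (ItemState.left, c, o) .comma =
          (ItemState.left, c', o') := by
        simp [Transducer.next, itemise, itemStep]
      obtain ⟨c', o', h1⟩ := h1
      rw [Block.code, Transducer.steps_cons, h1, itemise_formula int b (by simp)] at h hbad
      obtain ⟨Γ, Δ, rfl, h2⟩ := ih h hbad
      exact ⟨A :: Γ, Δ, rfl, h2⟩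
    | turnstile =>
      have h1 : ∃ c' o', (itemise int b).steps (ItemState.left, c, o) Block.turnstile.code =
          (ItemState.right false, c', o') := by
        simp [Transducer.steps, Transducer.next, itemise, itemStep, Block.code]
      obtain ⟨c', o', h1⟩ := h1
      rw [h1] at h hbad
      obtain ⟨Δ, rfl, -⟩ := exists_right_of_steps int b hbad
      refine ⟨[], Δ, rfl, fun hi => ?_⟩
      subst hi
      exact length_le_one_of_steps b h
    | _ =>
      refine (hbad (itemise_steps_bad int b ?_ _)).elim
      rw [Block.code, Transducer.steps_cons]
      exact itemise_steps_bad int b rfl _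

end Itemise

/-! ### The game made from two sequents -/

section Classical

open Classical in
/-- The transducer that turns a sequent of `L` into a player. -/
noncomputable def itemiser (L : ResourceLogic) (b : Bool) : Transducer ItemState :=
  itemise (decide L.intuitionistic) b

variable {L : ResourceLogic}

theorem inLang_sequentBlocks_iff {Γ Δ : List Formula} {S : Set Conn} :
    (∀ x ∈ sequentBlocks Γ Δ, x.InLang S) ↔
      (∀ A ∈ Γ, A.InLang S) ∧ ∀ A ∈ Δ, A.InLang S := by
  simp [sequentBlocks, or_imp, forall_and, Block.InLang]

/-- The implication from the renamed formula of the sequent to the fresh atom. -/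
noncomputable def sequentItem (L : ResourceLogic) (Γ Δ : List Formula) : Formula :=
  (L.sequentFormula Γ Δ).rename.lolli freshAtom

theorem run_itemiser {Γ Δ : List Formula} (hs : L.IsSequent Γ Δ) (b : Bool) :
    ((itemiser L b).run (sequentCode Γ Δ)).1 ∈ (itemiser L b).good ∧
    (itemiser L b).output ((itemiser L b).run (sequentCode Γ Δ)) =
      playerCode freshAtom [⟨sequentItem L Γ Δ, b, !b⟩] := by
  classical
  have h0 : (itemiser L b).run (sequentCode Γ Δ) = (itemiser L b).steps
      ((itemiser L b).next ((itemiser L b).steps (ItemState.left, [], fun _ => [])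
        (Γ.flatMap fun A => Token.comma :: A.code)) .turnstile)
      (Δ.flatMap fun A => Token.comma :: A.code) := by
    rw [← Transducer.steps_cons, ← Transducer.steps_append]
    rfl
  rw [h0]
  by_cases hL : L.intuitionistic
  · obtain ⟨B, hB⟩ := Multiset.card_eq_one.1 (hs.2.2 hL)
    obtain rfl := Multiset.coe_eq_singleton.1 hB
    have h1 : itemiser L b = itemise true b := by simp [itemiser, hL]
    have h2 : ∀ o, (itemise true b).next (ItemState.left, [], o) .turnstile =
        (ItemState.right false, [], fun i => o i ++ if i = 0 then
          [.player, .atom, .item b !b, .conn .lolli] else if i = 1 then [] else [.atom]) := by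
      intro o
      simp [Transducer.next, itemise, itemStep]
    rw [h1, itemise_left, h2, List.flatMap_singleton, itemise_right_singleton]
    have h3 : ItemState.right true ∈ (itemise true b).good := ⟨true, rfl, fun _ => rfl⟩
    refine ⟨h3, ?_⟩
    rw [Transducer.output, if_pos h3]
    simp [emit, playerCode, sequentItem, ResourceLogic.sequentFormula, rename_curry, Formula.code,
      code_curry, ResourceLogic.conclusion, hL, freshAtom, List.flatMap_map]
  · have h1 : itemiser L b = itemise false b := by simp [itemiser, hL]
    have h2 : ∀ o, (itemise false b).next (ItemState.left, [], o) .turnstile =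
        (ItemState.right false, [], fun i => o i ++ if i = 0 then
          [.player, .atom, .item b !b, .conn .lolli] else if i = 1 then [] else
            [.conn .neg, .conn .one, .atom]) := by
      intro o
      simp [Transducer.next, itemise, itemStep]
    rw [h1, itemise_left, h2, itemise_right]
    have h3 : ∀ k, ItemState.right k ∈ (itemise false b).good := fun k =>
      ⟨k, rfl, fun h => by simp at h⟩
    have h4 : ∀ A : Formula, A.neg.rename = A.rename.neg := fun _ => rfl
    have h5 : Formula.one.rename = Formula.one := rfl
    refine ⟨h3 _, ?_⟩
    rw [Transducer.output, if_pos (h3 _)]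
    simp [emit, playerCode, sequentItem, ResourceLogic.sequentFormula, rename_curry, Formula.code,
      code_curry, ResourceLogic.conclusion, hL, freshAtom, List.flatMap_map, h4, h5]

/-- A sequent of the logic is turned into a player that gets the fresh atom if and only if the
sequent is provable; other words are turned into the empty word. -/
theorem apply_itemiser (w : List Token) :
    (w ∉ sequentValidity L ∧ ∀ b, (itemiser L b).apply L.conn w = []) ∨
    ∃ A : Formula, A.InLang L.conn ∧
      (w ∈ sequentValidity L ↔ L.Provable {A} {freshAtom}) ∧
      ∀ b, (itemiser L b).apply L.conn w = playerCode freshAtom [⟨A, b, !b⟩] := by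
  classical
  by_cases h : ∃ Γ Δ : List Formula, w = sequentCode Γ Δ ∧ L.IsSequent Γ Δ
  · obtain ⟨Γ, Δ, rfl, hs⟩ := h
    have hf := ResourceLogic.inLang_sequentFormula hs
    refine Or.inr ⟨sequentItem L Γ Δ, ResourceLogic.inLang_lolli.2
      ⟨ResourceLogic.inLang_rename hf, trivial⟩, ?_, fun b => ?_⟩
    · rw [sequentCode_mem_iff, sequentItem, ResourceLogic.provable_rename_lolli_iff hf,
        ResourceLogic.provable_sequentFormula_iff hs]
    · rw [Transducer.apply, if_pos, (run_itemiser hs b).2]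
      refine ⟨sequentBlocks Γ Δ, ?_⟩
      rw [← code_sequentBlocks]
      exact Parse.read_blocks (inLang_sequentBlocks_iff.2 ⟨fun A hA => hs.1 A (by simpa using hA),
        fun A hA => hs.2.1 A (by simpa using hA)⟩)
  · refine Or.inl ⟨?_, fun b => ?_⟩
    · rintro ⟨Γ, Δ, rfl, hp⟩
      exact h ⟨Γ, Δ, rfl, hp.isSequent⟩
    · rw [Transducer.apply]
      split_ifs with hB
      · obtain ⟨B, hB⟩ := hB
        obtain ⟨h1, -, h2⟩ := Parse.read_sound hB
        have h3 : w = B.flatMap Block.code := by simpa [Parse.code] using h1.symm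
        rw [Transducer.output, if_neg]
        intro hg
        rw [h3] at hg
        obtain ⟨Γ, Δ, rfl, h4⟩ := exists_sequent_of_steps _ b hg
        obtain ⟨h5, h6⟩ := inLang_sequentBlocks_iff.1 h2
        exact h ⟨Γ, Δ, h3.trans (code_sequentBlocks Γ Δ), fun A hA => h5 A (by simpa using hA),
          fun A hA => h6 A (by simpa using hA), fun hi => by simpa using h4 (by simpa using hi)⟩
      · rfl

end Classical

/-- The players made from two sequents form a game in which the first player prefers the first
profile if and only if the first sequent is provable and the second is not. -/
theorem append_mem_dichotomousPreference_iff {L : ResourceLogic} (w w' : List Token) :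
    (itemiser L true).apply L.conn w ++ (itemiser L false).apply L.conn w' ∈
      dichotomousPreference L ↔ w ∈ sequentValidity L ∧ w' ∉ sequentValidity L := by
  -- No ticks are written, so the chosen player is the first one in the word, whichever sequent it
  -- came from.
  have key : ∀ ps : List (Formula × List MarkedResource), PlayersInLang L.conn ps →
      ∀ hi : 0 < ps.length, gameCode 0 ps ∈ dichotomousPreference L ↔
        L.Provable (contribution true ps) {ps[0].1} ∧
          ¬ L.Provable (contribution false ps) {ps[0].1} := by
    intro ps hps hi
    rw [gameCode_mem_iff, apply_extract _ hps hi, apply_extract _ hps hi, sequentCode_mem_iff,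
      sequentCode_mem_iff]
    simp
  have hp : freshAtom.InLang L.conn := trivial
  rcases apply_itemiser (L := L) w with ⟨h1, h2⟩ | ⟨A, hA, h1, h2⟩ <;>
    rcases apply_itemiser (L := L) w' with ⟨h3, h4⟩ | ⟨A', hA', h3, h4⟩ <;> rw [h2, h4]
  -- Neither word is a sequent: the empty word has no player to choose.
  · refine iff_of_false (fun h => ?_) fun h => h1 h.1
    obtain ⟨i, ps, hi, hw, -⟩ := mem_dichotomousPreference_iff.1 h
    cases ps with
    | nil => simp at hi
    | cons p ps => simp [gameCode, playerCode] at hw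
  -- Only the second word is a sequent: nothing is contributed in the first profile, so the goal is
  -- not reached there.
  · have h5 := key [(freshAtom, [⟨A', false, true⟩])] (by simp [PlayersInLang, hA', hp]) (by simp)
    change _ ↔ L.Provable 0 {freshAtom} ∧ ¬ L.Provable {A'} {freshAtom} at h5
    simp only [gameCode, List.replicate_zero, List.nil_append, List.flatMap_cons,
      List.flatMap_nil, List.append_nil] at h5
    simp only [List.nil_append, Bool.not_false, h5]
    exact iff_of_false (fun h => ResourceLogic.not_provable_atom [] h.1) fun h => h1 h.1
  -- Only the first word is a sequent: the outcome of the second profile is empty and does not give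
  -- the goal, in agreement with the invalidity of `w'`.
  · have h5 := key [(freshAtom, [⟨A, true, false⟩])] (by simp [PlayersInLang, hA, hp]) (by simp)
    change _ ↔ L.Provable {A} {freshAtom} ∧ ¬ L.Provable 0 {freshAtom} at h5
    simp only [gameCode, List.replicate_zero, List.nil_append, List.flatMap_cons,
      List.flatMap_nil, List.append_nil] at h5
    simp only [List.append_nil, Bool.not_true, h5, h1]
    exact and_congr_right fun _ => iff_of_true (ResourceLogic.not_provable_atom []) h3
  · have h5 := key [(freshAtom, [⟨A, true, false⟩]), (freshAtom, [⟨A', false, true⟩])]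
      (by simp [PlayersInLang, hA, hA', hp]) (by simp)
    change _ ↔ L.Provable {A} {freshAtom} ∧ ¬ L.Provable {A'} {freshAtom} at h5
    simp only [gameCode, List.replicate_zero, List.nil_append, List.flatMap_cons,
      List.flatMap_nil, List.append_nil] at h5
    simp only [Bool.not_true, Bool.not_false, h5, h1, h3]

/-! ## The main theorem -/

namespace ComplexityClass

/-- If sequent validity is hard for `C`, then dichotomous strong preference is hard for the
intersections of a language in `C` with the complement of a language in `C`. -/
theorem polyReduces_of_complete {C : ComplexityClass} {L : ResourceLogic}
    (hV : C.Complete (sequentValidity L)) {β : Type} [Finite β] {A A' : Language β}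
    (hA : A ∈ C β) (hA' : A'ᶜ ∈ C β) : PolyReduces (A ⊓ A') (dichotomousPreference L) := by
  obtain ⟨f, hf, hf'⟩ := hV.2 β A hA
  obtain ⟨g, hg, hg'⟩ := hV.2 β A'ᶜ hA'
  -- Each reduction supplies one player, and a concatenation of players is again the code of an
  -- instance with index zero.
  refine ⟨fun w => (itemiser L true).apply L.conn (f w) ++ (itemiser L false).apply L.conn (g w),
    (((itemiser L true).polyTimeComputable_apply L.conn).comp hf).append
      (((itemiser L false).polyTimeComputable_apply L.conn).comp hg), fun w => ?_⟩
  rw [append_mem_dichotomousPreference_iff, ← hf', ← hg']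
  exact and_congr Iff.rfl not_not.symm

theorem dichotomousPreference_eq (L : ResourceLogic) : dichotomousPreference L =
    ({w | (extract true).apply L.conn w ∈ sequentValidity L} : Language Token) ⊓
      ({w | (extract false).apply L.conn w ∈ sequentValidity L} : Language Token)ᶜ :=
  Set.ext fun _ => gameCode_mem_iff

end ComplexityClass

/-- When sequent validity in the logic is `NP`-complete, the problem of dichotomous strong
preference is complete for `BH₂ = NP ∧ coNP`; when it is `PSPACE`-complete, so is the problem of
dichotomous strong preference. -/
theorem mainTheorem9 (LOG : ResourceLogic) :
    (ComplexityClass.NP.Complete (sequentValidity LOG) →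
      ComplexityClass.BH₂.Complete (dichotomousPreference LOG)) ∧
    (ComplexityClass.PSPACE.Complete (sequentValidity LOG) →
      ComplexityClass.PSPACE.Complete (dichotomousPreference LOG)) := by
  have hf := fun b => (extract b).polyTimeComputable_apply LOG.conn
  constructor
  · intro hV
    refine ⟨⟨_, ComplexityClass.preimage_mem_NP (hf true) hV.1, _, ?_,
      ComplexityClass.dichotomousPreference_eq LOG⟩, ?_⟩
    · have h := ComplexityClass.preimage_mem_NP (hf false) hV.1
      -- Membership in `NP.co` is a statement about the complement, so the preimage in NP is written
      -- as a double complement.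
      rw [← compl_compl ({w | _} : Language Token)] at h
      exact h
    · rintro β _ B ⟨A, hA, A', hA', rfl⟩
      exact ComplexityClass.polyReduces_of_complete hV hA hA'
  · intro hV
    refine ⟨?_, fun β _ B hB => ?_⟩
    · rw [ComplexityClass.dichotomousPreference_eq]
      exact ComplexityClass.inf_mem_PSPACE (ComplexityClass.preimage_mem_PSPACE (hf true) hV.1)
        (ComplexityClass.compl_mem_PSPACE (ComplexityClass.preimage_mem_PSPACE (hf false) hV.1))
    -- Since PSPACE is closed under complement, `B = B ⊓ B` has the form required by the general
    -- reduction.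
    · rw [← inf_idem B]
      exact ComplexityClass.polyReduces_of_complete hV hB (ComplexityClass.compl_mem_PSPACE hB)
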